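/- Fix an o-minimal structure over $\mathbb R$; "definable" means definable in it with parameters, and the empty set counts as connected. **Definitions.** A coordinate cone in $\mathbb R^n$ is an intersection of sets $\{x_j\,\sigma\,c\}$, $\sigma\in\{<,=,>\}$, $c\in\mathbb R$, with at most one such set for each $j$. A (possibly empty) definable open bounded set $X\subset\mathbb R^n$ is *semi-monotone* if $X\cap C$ is connected for every coordinate cone $C$. A definable function $f:X\to\mathbb R$ on a non-empty semi-monotone set is *independent of* $x_j$ on $X$ if $f(\mathbf x)=f(\mathbf y)$ whenever $\mathbf x,\mathbf y\in X$ differ only in the coordinate $x_j$; it is *strictly increasing* (resp. *strictly decreasing*) *in* $x_j$ if $f(\mathbf x)<f(\mathbf y)$ (resp. $f(\mathbf x)>f(\mathbf y)$) for all such pairs with $x_j<y_j$. A bounded upper semi-continuous function $f$ on $X$ is *submonotone* if $\{\mathbf x\in X: f(\mathbf x)<b\}$ is semi-monotone for every $b\in\mathbb R$, and $f$ is *supermonotone* if $-f$ is submonotone. A definable $f$ is a *monotone function* if it is both sub- and supermonotone and, for each $j$, is strictly increasing in, strictly decreasing in, or independent of $x_j$. Let $\mathbf f=(f_1,\dots,f_k):X\to\mathbb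 R^k$, $k\ge1$, be a definable continuous bounded map on a non-empty semi-monotone set $X\subset\mathbb R^n$, with graph $\mathbf F\subset\mathbb R^{n+k}$, in coordinates $x_1,\dots,x_n,y_1,\dots,y_k$. A set $H$ of exactly $n$ of these coordinates is a *basis set* of $\mathbf f$ if the map $X\to\mathbb R^n$ formed by the functions $x_j$ $(x_j\in H)$ and $f_i$ $(y_i\in H)$ is injective. *Monotone maps* are defined by induction on $n$. For $n=0$ ($X$ is a point) every such $\mathbf f$ is monotone. For $n=1$, $\mathbf f$ is monotone if every $f_i$ is a monotone function. For $n\ge2$, $\mathbf f$ is monotone if for all $i,j$ such that $f_i$ is not independent of $x_j$: (i) for every $b\in\mathbb R$ the set $\mathbf F\cap\{y_i=b\}$, with the coordinate $y_i$ omitted, is empty or the graph of a monotone map $\mathbf f_{i,j,b}$ from a semi-monotone subset of $\mathrm{span}\{x_1,\dots,x_{j-1},x_{j+1},\dots,x_n\}$ to $\mathrm{span}\{y_1,\dots,y_{i-1},x_j,y_{i+1},\dots,y_k\}$; (ii) the system of basis sets of $\mathbf f_{i,j,b}$ is the same for all $b$ for which this set is non-empty. **Theorem.** Let $\mathbf f:X\to\mathbb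 R^k$ be a monotone map on a non-empty semi-monotone set $X\subset\mathbb R^n$, with graph $\mathbf F\subset\mathbb R^{n+k}$. The basis sets of $\mathbf f$ are the bases of a matroid $\mathbf m$ with ground set $\{x_1,\dots,x_n,y_1,\dots,y_k\}$ (the matroid associated with $\mathbf f$). For every subset $I\subset\{x_1,\dots,x_n,y_1,\dots,y_k\}$, with $T=\mathrm{span}\,I$ the space with coordinates $I$, the image $\rho_T(\mathbf F)\subset T$ of $\mathbf F$ under the coordinate projection is either a semi-monotone set in $T$, or the graph of a monotone map $\mathbf g$ from a subset of $\mathrm{span}\,H$ to $\mathrm{span}(I\setminus H)$ for some $H\subsetneq I$, whose associated matroid (a matroid with ground set $I$, whose bases are the basis sets of $\mathbf g$) is a minor of $\mathbf m$. -/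

import Mathlib

universe u v

/-- The language `L` interpreted on `ℝ` is an o-minimal structure over `ℝ`: the order is definable,
and every subset of `ℝ` definable with parameters is a finite union of points and open intervals
(bounded or not). -/
structure IsOMinimal (L : FirstOrder.Language.{u, v}) [L.Structure ℝ] : Prop where
  definable_lt : (Set.univ : Set ℝ).Definable L {z : Fin 2 → ℝ | z 0 < z 1}
  finite_union : ∀ s : Set ℝ, (Set.univ : Set ℝ).Definable₁ L s →
    ∃ P : Set (Set ℝ), P.Finite ∧ s = ⋃₀ P ∧
      ∀ c ∈ P, (∃ a : ℝ, c = {a}) ∨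
        ∃ a b : EReal, c = {t : ℝ | a < (t : EReal) ∧ (t : EReal) < b}

/-- Coordinate cones in `ℝ^ι`: for each coordinate at most one condition
`x j < c`, `x j = c` or `x j > c`. -/
def IsCoordinateCone {ι : Type*} (C : Set (ι → ℝ)) : Prop :=
  ∃ A : ι → Set ℝ,
    (∀ j, A j = Set.univ ∨ ∃ c : ℝ, A j = Set.Iio c ∨ A j = {c} ∨ A j = Set.Ioi c) ∧
      C = {x | ∀ j, x j ∈ A j}

/-- Semi-monotone sets. The empty set counts as connected, hence `IsPreconnected`. -/
structure IsSemiMonotone (L : FirstOrder.Language.{u, v}) [L.Structure ℝ] {ι : Type}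
    (X : Set (ι → ℝ)) : Prop where
  definable : (Set.univ : Set ℝ).Definable L X
  isOpen : IsOpen X
  isBounded : Bornology.IsBounded X
  connected : ∀ C : Set (ι → ℝ), IsCoordinateCone C → IsPreconnected (X ∩ C)

/-- The graph in `ℝ^(ι ⊕ κ)` of the restriction of `f` to `X`. -/
def graphOf {ι κ : Type} (X : Set (ι → ℝ)) (f : (ι → ℝ) → κ → ℝ) : Set (ι ⊕ κ → ℝ) :=
  (fun x => Sum.elim x (f x)) '' X

/-- `f` restricted to `X` is a definable map. -/
def IsDefinableMap (L : FirstOrder.Language.{u, v}) [L.Structure ℝ] {ι κ : Type}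
    (X : Set (ι → ℝ)) (f : (ι → ℝ) → κ → ℝ) : Prop :=
  (Set.univ : Set ℝ).Definable L (graphOf X f)

/-- `f` is strictly increasing in the coordinate `j` on `X`. -/
def StrictIncreasingIn {ι : Type} (X : Set (ι → ℝ)) (f : (ι → ℝ) → ℝ) (j : ι) : Prop :=
  ∀ x ∈ X, ∀ y ∈ X, (∀ i, i ≠ j → x i = y i) → x j < y j → f x < f y

/-- `f` is strictly decreasing in the coordinate `j` on `X`. -/
def StrictDecreasingIn {ι : Type} (X : Set (ι → ℝ)) (f : (ι → ℝ) → ℝ) (j : ι) : Prop :=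
  ∀ x ∈ X, ∀ y ∈ X, (∀ i, i ≠ j → x i = y i) → x j < y j → f y < f x

/-- `f` is independent of the coordinate `j` on `X`. -/
def IndependentOf {ι : Type} (X : Set (ι → ℝ)) (f : (ι → ℝ) → ℝ) (j : ι) : Prop :=
  ∀ x ∈ X, ∀ y ∈ X, (∀ i, i ≠ j → x i = y i) → f x = f y

/-- Submonotone functions on a non-empty semi-monotone set. -/
structure IsSubmonotone (L : FirstOrder.Language.{u, v}) [L.Structure ℝ] {ι : Type}
    (X : Set (ι → ℝ)) (f : (ι → ℝ) → ℝ) : Prop where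
  nonempty : X.Nonempty
  semiMonotone : IsSemiMonotone L X
  bounded : Bornology.IsBounded (f '' X)
  usc : UpperSemicontinuousOn f X
  sublevel : ∀ b : ℝ, IsSemiMonotone L {x ∈ X | f x < b}

/-- Supermonotone functions: `-f` is submonotone. -/
def IsSupermonotone (L : FirstOrder.Language.{u, v}) [L.Structure ℝ] {ι : Type}
    (X : Set (ι → ℝ)) (f : (ι → ℝ) → ℝ) : Prop :=
  IsSubmonotone L X (fun x => -f x)

/-- Definable monotone functions on a non-empty semi-monotone set. -/
structure IsMonotoneFunction (L : FirstOrder.Language.{u, v}) [L.Structure ℝ] {ι : Type}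
    (X : Set (ι → ℝ)) (f : (ι → ℝ) → ℝ) : Prop where
  definable : IsDefinableMap L X (fun x (_ : Unit) => f x)
  submonotone : IsSubmonotone L X f
  supermonotone : IsSupermonotone L X f
  coordinate : ∀ j,
    StrictIncreasingIn X f j ∨ StrictDecreasingIn X f j ∨ IndependentOf X f j

/-- Basis sets of a map `f` from `X ⊆ ℝ^n` to `ℝ^k`. The label `Sum.inl j` stands for the domain
coordinate `x j` and `Sum.inr i` for the target coordinate `y i`. -/
def IsBasisSet {n k : ℕ} (X : Set (Fin n → ℝ)) (f : (Fin n → ℝ) → Fin k → ℝ)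
    (H : Set (Fin n ⊕ Fin k)) : Prop :=
  H.ncard = n ∧ Set.InjOn (fun x (h : H) => Sum.elim x (f x) h) X

/-- The maps among which the monotone ones are singled out: definable, continuous and bounded maps
from a non-empty semi-monotone subset of `ℝ^n` to `ℝ^k`, with `k ≥ 1`. -/
structure IsBoundedContinuousMap (L : FirstOrder.Language.{u, v}) [L.Structure ℝ] {n k : ℕ}
    (X : Set (Fin n → ℝ)) (f : (Fin n → ℝ) → Fin k → ℝ) : Prop where
  one_le : 1 ≤ k
  nonempty : X.Nonempty
  semiMonotone : IsSemiMonotone L X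
  definable : IsDefinableMap L X f
  continuousOn : ContinuousOn f X
  bounded : Bornology.IsBounded (f '' X)

/-- The part `F ∩ {y i = b}` of the graph `F` of `f`, with `y i` omitted, and with the remaining
coordinates ordered so that `x j` leaves the domain coordinates and takes the place of `y i` among
the target coordinates. -/
def levelGraph {n k : ℕ} (X : Set (Fin (n + 1) → ℝ)) (f : (Fin (n + 1) → ℝ) → Fin k → ℝ)
    (i : Fin k) (j : Fin (n + 1)) (b : ℝ) : Set (Fin n ⊕ Fin k → ℝ) :=
  (fun x => Sum.elim (j.removeNth x) (Function.update (f x) i (x j))) '' {x ∈ X | f x i = b}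

/-- Monotone maps, by induction on the dimension `n` of the domain. On a one-point domain (`n = 0`)
every map is monotone. In the inductive step, `g b` on `Y b` is the map whose graph is the level set
`F ∩ {y i = b}`, for those `b` for which that level set is non-empty. -/
def IsMonotoneMap (L : FirstOrder.Language.{u, v}) [L.Structure ℝ] {k : ℕ} :
    (n : ℕ) → (X : Set (Fin n → ℝ)) → (f : (Fin n → ℝ) → Fin k → ℝ) → Prop
  | 0, X, f => IsBoundedContinuousMap L X f
  | 1, X, f => IsBoundedContinuousMap L X f ∧ ∀ i, IsMonotoneFunction L X (fun x => f x i)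
  | n + 2, X, f => IsBoundedContinuousMap L X f ∧
      ∀ (i : Fin k) (j : Fin (n + 2)), ¬ IndependentOf X (fun x => f x i) j →
        ∃ (Y : ℝ → Set (Fin (n + 1) → ℝ)) (g : ℝ → (Fin (n + 1) → ℝ) → Fin k → ℝ),
          (∀ b : ℝ, (levelGraph X f i j b).Nonempty →
            levelGraph X f i j b = graphOf (Y b) (g b) ∧ IsMonotoneMap L (n + 1) (Y b) (g b)) ∧
          (∀ b b' : ℝ, (levelGraph X f i j b).Nonempty → (levelGraph X f i j b').Nonempty →
            ∀ H : Set (Fin (n + 1) ⊕ Fin k),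
              IsBasisSet (Y b) (g b) H ↔ IsBasisSet (Y b') (g b') H)

/-- `m` is the matroid associated with `f`: its ground set consists of all the coordinates and its
bases are the basis sets of `f`. (Such an `m` is unique if it exists.) -/
def IsAssociatedMatroid {n k : ℕ} (X : Set (Fin n → ℝ)) (f : (Fin n → ℝ) → Fin k → ℝ)
    (m : Matroid (Fin n ⊕ Fin k)) : Prop :=
  m.E = Set.univ ∧ ∀ H, m.IsBase H ↔ IsBasisSet X f H

/-- The projection of `F` to the span of the coordinates in `I`. -/
def projectTo {κ : Type} (I : Set κ) (F : Set (κ → ℝ)) : Set (I → ℝ) :=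
  (fun z (c : I) => z c) '' F

/-! Everything passes through one notion, `Represents M F`: `F` is nonempty, fixing any coordinates
leaves it connected, closure in the matroid `M` forces functional dependence on `F`, and `F`
projects openly to independent coordinates. It is inherited by coordinate projections, with the
matroid restricted (`Represents.comap`), and by nonempty level sets of a nonloop coordinate, with
the matroid contracted (`Represents.contract`).

The graph of a monotone map is represented by a matroid (`IsMonotoneMap.exists_represents`,
induction on dimension). Its bases are the charts: sets of `n` coordinates with injective and open
projection. The crux is a dichotomy: when `e` replaces `a` in a chart, either the new projection is
injective or `e` is a function of the rest of the chart. It is inherited from the level sets,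
condition (ii) forcing the same alternative on all of them, and it yields basis exchange
(`exists_represents`).

Conversely, a bounded definable graph represented by a matroid in which the domain coordinates form
a base is monotone (`Represents.isMonotoneMap`): its level sets are represented by one contraction,
the same for every level.

For the projection to `I`, take a basis `J` of `I`. If `J = I`, the image is open and meets cones in
connected sets; otherwise it is a graph over the coordinates in `J`, represented by the restriction
of the matroid to `I`, which is a minor. -/

open Set Topology

/-! ### Functional dependence, open projections and connected slices -/

/-- On `F`, the coordinate `e` is a function of the coordinates in `S`. -/
def Determines {κ : Type} (F : Set (κ → ℝ)) (S : Set κ) (e : κ) : Prop :=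
  ∀ z ∈ F, ∀ w ∈ F, (∀ s ∈ S, z s = w s) → z e = w e

/-- The coordinate projection of `F` to `ℝ^B` is an open map. -/
def ProjectsOpenly {κ : Type} (F : Set (κ → ℝ)) (B : Set κ) : Prop :=
  ∀ z ∈ F, ∀ ε > 0, ∃ δ > 0, ∀ y : κ → ℝ, (∀ b ∈ B, |y b - z b| < δ) →
    ∃ w ∈ F, (∀ b ∈ B, w b = y b) ∧ ∀ c, |w c - z c| < ε

/-- The intersections of `F` with affine coordinate subspaces are connected. -/
def HasConnectedSlices {κ : Type} (F : Set (κ → ℝ)) : Prop :=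
  ∀ (S : Set κ) (z : κ → ℝ), IsPreconnected (F ∩ {w | ∀ s ∈ S, w s = z s})

section Basic

variable {κ : Type} {F : Set (κ → ℝ)} {S T B : Set κ} {e : κ}

theorem Determines.mono (h : Determines F S e) (hST : S ⊆ T) : Determines F T e :=
  fun z hz w hw hzw => h z hz w hw fun s hs => hzw s (hST hs)

theorem Determines.of_mem (h : e ∈ S) : Determines F S e :=
  fun _ _ _ _ hzw => hzw e h

theorem ProjectsOpenly.mono (h : ProjectsOpenly F T) (hST : S ⊆ T) : ProjectsOpenly F S := by
  classical
  intro z hz ε hε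
  obtain ⟨δ, hδ, H⟩ := h z hz ε hε
  refine ⟨δ, hδ, fun y hy => ?_⟩
  obtain ⟨w, hw, hwy, hwz⟩ := H (fun c => if c ∈ S then y c else z c) (fun b _ => by
    by_cases hb : b ∈ S
    · simpa [hb] using hy b hb
    · simpa [hb] using hδ)
  exact ⟨w, hw, fun b hb => by simpa [hb] using hwy b (hST hb), hwz⟩

theorem eq_of_determines (h : ∀ e, Determines F S e) {z w : κ → ℝ} (hz : z ∈ F) (hw : w ∈ F)
    (hzw : ∀ s ∈ S, z s = w s) : z = w :=
  funext fun e => h e z hz w hw hzw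

/-- A coordinate of an open set of coordinates can be moved on `F` with the others fixed. -/
theorem ProjectsOpenly.exists_move (h : ProjectsOpenly F B) {z : κ → ℝ} (hz : z ∈ F) {b : κ}
    (hb : b ∈ B) : ∃ w ∈ F, w b ≠ z b ∧ ∀ c ∈ B, c ≠ b → w c = z c := by
  classical
  obtain ⟨δ, hδ, H⟩ := h z hz 1 one_pos
  obtain ⟨w, hw, hwy, -⟩ := H (Function.update z b (z b + δ / 2)) (fun c _ => by
    by_cases hc : c = b
    · subst hc
      rw [Function.update_self, add_sub_cancel_left, abs_of_pos (half_pos hδ)]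
      exact half_lt_self hδ
    · simp [hc, hδ])
  refine ⟨w, hw, ?_, fun c hc hcb => by simpa [hcb] using hwy c hc⟩
  rw [hwy b hb]
  simp [hδ.ne']

/-- On a slice fixing `S \ {b}`, which is connected, `e` is locally constant: to pass from `v` to a
nearby `u`, first move only `b` within `B`, which keeps `e` because `e` ignores `b`, and then
compare two points that agree on `S`. Connectedness is asked only for slices by subsets of `B`,
because for a graph over its domain coordinates only these are known to be connected at first. -/
theorem Determines.diff_singleton (hB : ProjectsOpenly F B)
    (hF : ∀ S ⊆ B, ∀ z : κ → ℝ, IsPreconnected (F ∩ {w | ∀ s ∈ S, w s = z s}))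
    (hS : Determines F S e) {b : κ} (hb : Determines F (B \ {b}) e) (hSB : S ⊆ B) [Fintype κ] :
    Determines F (S \ {b}) e := by
  classical
  intro z hz w hw hzw
  refine (hF (S \ {b}) (sdiff_subset.trans hSB) z).induction₂ (fun u v => u e = v e) ?_ (fun _ _ _ _ _ _ h h' => h.trans h')
    (fun _ _ _ _ h => h.symm) ⟨hz, fun _ _ => rfl⟩ ⟨hw, fun s hs => (hzw s hs).symm⟩
  rintro v ⟨hv, hvz⟩
  obtain ⟨δ, hδ, H⟩ := hB v hv 1 one_pos
  filter_upwards [self_mem_nhdsWithin, mem_nhdsWithin_of_mem_nhds (Metric.ball_mem_nhds v hδ)]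
    with u hu huv
  -- The intermediate point `w'` has the `B`-coordinates of `v`, except that `b` is taken from `u`.
  obtain ⟨w', hw', hwy, -⟩ := H (Function.update v b (u b)) (fun c _ => by
    by_cases hc : c = b
    · subst hc
      simpa [Real.dist_eq] using (dist_le_pi_dist u v c).trans_lt huv
    · simp [hc, hδ])
  refine (hb v hv w' hw' fun s hs => ?_).trans (hS w' hw' u hu.1 fun s hs => ?_)
  · have := hwy s hs.1
    rw [this, Function.update_of_ne hs.2]
  · rw [hwy s (hSB hs)]
    by_cases hsb : s = b
    · subst hsb
      simp
    · rw [Function.update_of_ne hsb, hvz s ⟨hs, hsb⟩, hu.2 s ⟨hs, hsb⟩]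

/-- If `e` depends on no coordinate in `B \ S`, then it is a function of the coordinates in `S`. -/
theorem determines_of_forall_diff_singleton [Fintype κ] (hB : ProjectsOpenly F B)
    (hF : ∀ S ⊆ B, ∀ z : κ → ℝ, IsPreconnected (F ∩ {w | ∀ s ∈ S, w s = z s}))
    (hSB : S ⊆ B) (he : Determines F B e)
    (h : ∀ b ∈ B \ S, Determines F (B \ {b}) e) : Determines F S e := by
  suffices H : ∀ T : Set κ, T ⊆ B \ S → Determines F (B \ T) e by
    simpa [sdiff_sdiff_cancel_left hSB] using H (B \ S) subset_rfl
  intro T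
  induction T, T.toFinite using Set.Finite.induction_on with
  | empty => simpa using he
  | @insert b T _ _ ih =>
    intro hT
    have := (ih ((subset_insert _ _).trans hT)).diff_singleton hB hF
      (h b (hT (mem_insert _ _))) sdiff_subset
    rwa [sdiff_sdiff, union_singleton] at this

end Basic

/-! ### Openness survives a coordinate exchange -/

section Exchange

variable {κ : Type} [Fintype κ] {F : Set (κ → ℝ)} {B : Set κ}

/-- Openness lifts a nearby `x` to a point of `F` close to `W y`, and injectivity identifies that
point with `W x`. -/
theorem continuousOn_of_section (hB : ProjectsOpenly F B) (hinj : ∀ e, Determines F B e)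
    {W : (κ → ℝ) → κ → ℝ} {U : Set (κ → ℝ)}
    (hW : ∀ y ∈ U, W y ∈ F ∧ ∀ b ∈ B, W y b = y b) : ContinuousOn W U := by
  rw [Metric.continuousOn_iff]
  intro y hy ε hε
  obtain ⟨δ, hδ, H⟩ := hB _ (hW y hy).1 ε hε
  refine ⟨δ, hδ, fun x hx hxy => ?_⟩
  obtain ⟨w, hw, hwx, hwy⟩ := H x (fun b hb => by
    rw [(hW y hy).2 b hb]
    exact (dist_le_pi_dist x y b).trans_lt hxy)
  have : w = W x := eq_of_determines hinj hw (hW x hx).1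
    fun b hb => (hwx b hb).trans ((hW x hx).2 b hb).symm
  subst this
  exact (dist_pi_lt_iff hε).2 hwy

/-- If the projection to `ℝ^B` is injective and open, and `B'` is obtained from `B` by exchanging
one coordinate, then injectivity of the projection to `ℝ^B'` implies that it is open. -/
theorem ProjectsOpenly.exchange (hB : ProjectsOpenly F B) (hinj : ∀ e, Determines F B e) {a e : κ}
    (ha : a ∈ B) (he : e ∉ B) (hinj' : ∀ c, Determines F (insert e (B \ {a})) c) :
    ProjectsOpenly F (insert e (B \ {a})) := by
  classical
  intro z hz ε hε
  -- `W` inverts the projection to `ℝ^B`; the value `0` off the image is never used.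
  have hW : ∀ y : κ → ℝ, ∃ w, (∃ v ∈ F, ∀ b ∈ B, v b = y b) → w ∈ F ∧ ∀ b ∈ B, w b = y b := by
    intro y
    by_cases h : ∃ v ∈ F, ∀ b ∈ B, v b = y b
    · obtain ⟨v, hv⟩ := h
      exact ⟨v, fun _ => hv⟩
    · exact ⟨0, fun h' => absurd h' h⟩
  choose W hW using hW
  have hWc : ContinuousOn W {y | ∃ v ∈ F, ∀ b ∈ B, v b = y b} :=
    continuousOn_of_section hB hinj fun y hy => hW y hy
  have hWeq : ∀ w ∈ F, ∀ y, (∀ b ∈ B, w b = y b) → W y = w := fun w hw y hwy =>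
    eq_of_determines hinj (hW y ⟨w, hw, hwy⟩).1 hw
      fun b hb => ((hW y ⟨w, hw, hwy⟩).2 b hb).trans (hwy b hb).symm
  obtain ⟨δ, hδ, H⟩ := hB z hz ε hε
  set r := δ / 2 with hr
  have hr0 : 0 < r := by positivity
  have hrδ : r < δ := by linarith
  -- points near `z` and the lines through them
  have hline : ∀ y : κ → ℝ, (∀ b ∈ B, b ≠ a → |y b - z b| < δ) → ∀ t ∈ Icc (z a - r) (z a + r),
      (∃ v ∈ F, ∀ b ∈ B, v b = Function.update y a t b) ∧
        ∀ c, |W (Function.update y a t) c - z c| < ε := by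
    intro y hy t ht
    obtain ⟨w, hw, hwy, hwz⟩ := H (Function.update y a t) (fun b hb => by
      by_cases hba : b = a
      · subst hba
        simp only [Function.update_self]
        rw [abs_lt]
        constructor <;> linarith [ht.1, ht.2]
      · simpa [hba] using hy b hb hba)
    refine ⟨⟨w, hw, hwy⟩, ?_⟩
    rwa [hWeq w hw _ hwy]
  have hcont : ∀ y : κ → ℝ, (∀ b ∈ B, b ≠ a → |y b - z b| < δ) →
      ContinuousOn (fun t => W (Function.update y a t) e) (Icc (z a - r) (z a + r)) := by
    intro y hy
    have h1 : ContinuousOn (fun t => W (Function.update y a t)) (Icc (z a - r) (z a + r)) :=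
      hWc.comp (by fun_prop) fun t ht => (hline y hy t ht).1
    exact (continuous_apply e).comp_continuousOn h1
  have hz0 : ∀ b ∈ B, b ≠ a → |z b - z b| < δ := fun b _ _ => by simpa using hδ
  have hWz : W (Function.update z a (z a)) = z := hWeq z hz _ (by simp)
  -- Along the line through `z` in direction `a`, the other coordinates in `B` are fixed, so
  -- injectivity on the exchanged set makes `e` injective, hence strictly monotone. Its values at
  -- the two ends therefore lie on opposite sides of `z e`.
  have hginj : InjOn (fun t => W (Function.update z a t) e) (Icc (z a - r) (z a + r)) := by
    intro t ht t' ht' htt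
    have h1 := hW _ (hline z hz0 t ht).1
    have h2 := hW _ (hline z hz0 t' ht').1
    have h3 := hinj' a _ h1.1 _ h2.1 (by
      rintro s (rfl | hs)
      · exact htt
      · rw [h1.2 s hs.1, h2.2 s hs.1, Function.update_of_ne hs.2, Function.update_of_ne hs.2])
    rw [h1.2 a ha, h2.2 a ha] at h3
    simpa using h3
  have hmono := (hcont z hz0).strictMonoOn_of_injOn_Icc' (by linarith) hginj
  have hm1 : z a - r ∈ Icc (z a - r) (z a + r) := ⟨le_rfl, by linarith⟩
  have hm2 : z a ∈ Icc (z a - r) (z a + r) := ⟨by linarith, by linarith⟩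
  have hm3 : z a + r ∈ Icc (z a - r) (z a + r) := ⟨by linarith, le_rfl⟩
  set p := W (Function.update z a (z a - r)) with hp
  set q := W (Function.update z a (z a + r)) with hq
  have hpq : (p e < z e ∧ z e < q e) ∨ (q e < z e ∧ z e < p e) := by
    rcases hmono with h | h
    · left
      have h1 := h hm1 hm2 (by linarith)
      have h2 := h hm2 hm3 (by linarith)
      simp only [hWz] at h1 h2
      exact ⟨h1, h2⟩
    · right
      have h1 := h hm1 hm2 (by linarith)
      have h2 := h hm2 hm3 (by linarith)
      simp only [hWz] at h1 h2
      exact ⟨h2, h1⟩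
  -- Gaps of at least `2 * η` leave room to move each end value and the target `y e` by less than
  -- `η` without changing their order.
  obtain ⟨η, hη, hη1, hη2⟩ : ∃ η > 0, 2 * η ≤ |p e - z e| ∧ 2 * η ≤ |q e - z e| := by
    have h1 : 0 < |p e - z e| := abs_pos.2 (by rcases hpq with h | h <;> linarith [h.1, h.2] )
    have h2 : 0 < |q e - z e| := abs_pos.2 (by rcases hpq with h | h <;> linarith [h.1, h.2] )
    refine ⟨min |p e - z e| |q e - z e| / 2, by positivity, ?_, ?_⟩
    · linarith [min_le_left |p e - z e| |q e - z e|]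
    · linarith [min_le_right |p e - z e| |q e - z e|]
  have hpF := hW _ (hline z hz0 _ hm1).1
  have hqF := hW _ (hline z hz0 _ hm3).1
  obtain ⟨δ₁, hδ₁, H₁⟩ := hB p hpF.1 η hη
  obtain ⟨δ₂, hδ₂, H₂⟩ := hB q hqF.1 η hη
  refine ⟨min (min δ η) (min δ₁ δ₂), by positivity, fun y hy => ?_⟩
  have hyB : ∀ b ∈ B, b ≠ a → |y b - z b| < min (min δ η) (min δ₁ δ₂) :=
    fun b hb hba => hy b (Or.inr ⟨hb, hba⟩)
  have hyδ : ∀ b ∈ B, b ≠ a → |y b - z b| < δ := fun b hb hba =>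
    (hyB b hb hba).trans_le ((min_le_left _ _).trans (min_le_left _ _))
  have hye : |y e - z e| < η := (hy e (Or.inl rfl)).trans_le
    ((min_le_left _ _).trans (min_le_right _ _))
  have hend : ∀ (t δ' : ℝ) (v : κ → ℝ), 0 < δ' → min (min δ η) (min δ₁ δ₂) ≤ δ' →
      (∀ b ∈ B, v b = Function.update z a t b) →
      (∀ x : κ → ℝ, (∀ b ∈ B, |x b - v b| < δ') →
        ∃ w ∈ F, (∀ b ∈ B, w b = x b) ∧ ∀ c, |w c - v c| < η) →
      |W (Function.update y a t) e - v e| < η := by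
    intro t δ' v hδ' hle hv hx
    obtain ⟨w, hw, hwx, hwv⟩ := hx (Function.update y a t) (fun b hb => by
      rw [hv b hb]
      by_cases hba : b = a
      · subst hba
        simpa using hδ'
      · simpa [hba] using (hyB b hb hba).trans_le hle)
    rw [hWeq w hw _ hwx]
    exact hwv e
  have hP := hend _ δ₁ p hδ₁ ((min_le_right _ _).trans (min_le_left _ _)) hpF.2 H₁
  have hQ := hend _ δ₂ q hδ₂ ((min_le_right _ _).trans (min_le_right _ _)) hqF.2 H₂
  have hmem : y e ∈ uIcc (W (Function.update y a (z a - r)) e)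
      (W (Function.update y a (z a + r)) e) := by
    rw [mem_uIcc]
    rw [abs_lt] at hP hQ hye
    rcases hpq with ⟨h1, h2⟩ | ⟨h1, h2⟩
    · left
      rw [abs_of_neg (by linarith)] at hη1
      rw [abs_of_pos (by linarith)] at hη2
      constructor <;> linarith
    · right
      rw [abs_of_neg (by linarith)] at hη2
      rw [abs_of_pos (by linarith)] at hη1
      constructor <;> linarith
  have hle : z a - r ≤ z a + r := by linarith
  -- On the line through `y`, the end values still enclose `y e`, so `e` takes this value at some
  -- `t`.
  obtain ⟨t, ht, hte⟩ := intermediate_value_uIcc (by rw [uIcc_of_le hle]; exact hcont y hyδ) hmem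
  rw [uIcc_of_le hle] at ht
  obtain ⟨hex, hclose⟩ := hline y hyδ t ht
  refine ⟨_, (hW _ hex).1, ?_, hclose⟩
  rintro b (rfl | hb)
  · exact hte
  · rw [(hW _ hex).2 b hb.1, Function.update_of_ne hb.2]

end Exchange

/-! ### From connected slices to connected intersections with cones -/

section Cones

/-- In a separation of the lower half by `U` and `V`, the connected slice lies in one of them, say
`U`. Adding the open upper half to `U` and cutting `V` down to `w c < b` would then separate `A`. -/
theorem IsPreconnected.inter_coord_le {κ : Type} {A : Set (κ → ℝ)} (hA : IsPreconnected A) (c : κ)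
    {b : ℝ} (h : IsPreconnected (A ∩ {w | w c = b})) : IsPreconnected (A ∩ {w | w c ≤ b}) := by
  have aux : ∀ U V : Set (κ → ℝ), IsOpen U → IsOpen V → A ∩ {w | w c ≤ b} ⊆ U ∪ V →
      A ∩ {w | w c ≤ b} ∩ (U ∩ V) = ∅ → A ∩ {w | w c = b} ⊆ U →
      A ∩ {w | w c ≤ b} ⊆ U ∨ A ∩ {w | w c ≤ b} ⊆ V := by
    intro U V hU hV hUV hd hs
    have hgt : IsOpen {w : κ → ℝ | b < w c} := isOpen_lt continuous_const (continuous_apply c)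
    have hlt : IsOpen {w : κ → ℝ | w c < b} := isOpen_lt (continuous_apply c) continuous_const
    have hcov : A ⊆ (U ∪ {w | b < w c}) ∪ (V ∩ {w | w c < b}) := by
      intro w hw
      rcases lt_trichotomy (w c) b with hb | hb | hb
      · rcases hUV ⟨hw, hb.le⟩ with h' | h'
        · exact Or.inl (Or.inl h')
        · exact Or.inr ⟨h', hb⟩
      · exact Or.inl (Or.inl (hs ⟨hw, hb⟩))
      · exact Or.inl (Or.inr hb)
    have hdisj : A ∩ ((U ∪ {w | b < w c}) ∩ (V ∩ {w | w c < b})) = ∅ := by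
      refine eq_empty_of_forall_notMem ?_
      rintro w ⟨hw, hU' | hU', hV', hb⟩
      · exact (eq_empty_iff_forall_notMem.1 hd w) ⟨⟨hw, show w c ≤ b from le_of_lt hb⟩, hU', hV'⟩
      · exact lt_asymm (show b < w c from hU') hb
    refine (isPreconnected_iff_subset_of_disjoint.1 hA _ _ (hU.union hgt) (hV.inter hlt) hcov
      hdisj).imp (fun h1 => ?_) fun h1 w hw => (h1 hw.1).1
    rintro w ⟨hw, hwb : w c ≤ b⟩
    exact (h1 hw).resolve_right fun h : b < w c => not_lt.2 hwb h
  rw [isPreconnected_iff_subset_of_disjoint]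
  intro U V hU hV hUV hd
  have hsub : A ∩ {w | w c = b} ⊆ A ∩ {w | w c ≤ b} := fun w hw => ⟨hw.1, hw.2.le⟩
  rcases isPreconnected_iff_subset_of_disjoint.1 h U V hU hV (hsub.trans hUV)
    (subset_empty_iff.1 (hd ▸ inter_subset_inter_left _ hsub)) with h' | h'
  · exact aux U V hU hV hUV hd h'
  · exact (aux V U hV hU (union_comm U V ▸ hUV) (inter_comm U V ▸ hd) h').symm

/-- Any two points of the open half lie in a common closed half contained in it. -/
theorem IsPreconnected.inter_coord_lt {κ : Type} {A : Set (κ → ℝ)} (hA : IsPreconnected A) (c : κ)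
    (h : ∀ b, IsPreconnected (A ∩ {w | w c = b})) (b : ℝ) :
    IsPreconnected (A ∩ {w | w c < b}) := by
  refine isPreconnected_of_forall_pair fun x hx y hy => ?_
  refine ⟨A ∩ {w | w c ≤ max (x c) (y c)}, fun w hw => ⟨hw.1, ?_⟩,
    ⟨hx.1, le_max_left (x c) (y c)⟩, ⟨hy.1, le_max_right (x c) (y c)⟩, hA.inter_coord_le c (h _)⟩
  exact lt_of_le_of_lt hw.2 (max_lt (show x c < b from hx.2) hy.2)

theorem IsPreconnected.inter_coord_gt {κ : Type} {A : Set (κ → ℝ)} (hA : IsPreconnected A) (c : κ)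
    (h : ∀ b, IsPreconnected (A ∩ {w | w c = b})) (b : ℝ) :
    IsPreconnected (A ∩ {w | b < w c}) := by
  have himg : ∀ s : Set (κ → ℝ), IsPreconnected s → IsPreconnected (-s) := fun s hs => by
    rw [← image_neg_eq_neg]
    exact hs.image _ continuous_neg.continuousOn
  have h1 := (himg A hA).inter_coord_lt c (fun b => by
    convert himg _ (h (-b)) using 1
    ext w
    simp [neg_eq_iff_eq_neg]) (-b)
  convert himg _ h1 using 1
  ext w
  simp

/-- Induction on a set `T` of coordinates that may carry inequalities. Without inequalities the cone
is a slice; an inequality at `c` is reached from the sets where `c` is free or fixed, which the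
induction hypothesis covers. -/
theorem HasConnectedSlices.inter_cone {κ : Type} [Fintype κ] {F : Set (κ → ℝ)}
    (hF : HasConnectedSlices F) {C : Set (κ → ℝ)} (hC : IsCoordinateCone C) :
    IsPreconnected (F ∩ C) := by
  classical
  obtain ⟨A, hA, rfl⟩ := hC
  suffices H : ∀ (T : Finset κ) (A : κ → Set ℝ),
      (∀ j, A j = univ ∨ ∃ c : ℝ, A j = Iio c ∨ A j = {c} ∨ A j = Ioi c) →
      (∀ j ∉ T, A j = univ ∨ ∃ c : ℝ, A j = {c}) → IsPreconnected (F ∩ {x | ∀ j, x j ∈ A j}) from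
    H Finset.univ A hA (by simp)
  intro T
  induction T using Finset.induction_on with
  | empty =>
    intro A _ hA
    choose! v hv using fun j (hj : A j ≠ univ) => (hA j (by simp)).resolve_left hj
    convert hF {j | A j ≠ univ} v using 2
    ext w
    refine forall_congr' fun j => ?_
    by_cases hj : A j = univ
    · simp [hj]
    · have : w j ∈ A j ↔ w j = v j := by rw [hv j hj]; rfl
      simp [hj, this]
  | @insert c T hc ih =>
    intro A hA hAT
    have hupd : ∀ D : Set ℝ, F ∩ {x | ∀ j, x j ∈ Function.update A c D j} =
        F ∩ {x | ∀ j, j ≠ c → x j ∈ A j} ∩ {x | x c ∈ D} := by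
      intro D
      ext x
      simp only [mem_inter_iff, mem_ofPred_eq, and_assoc]
      refine and_congr_right fun _ => ⟨fun h => ⟨fun j hj => ?_, ?_⟩, fun h j => ?_⟩
      · simpa [hj] using h j
      · simpa using h c
      · by_cases hj : j = c
        · subst hj; simpa using h.2
        · simpa [hj] using h.1 j hj
    have hpre : ∀ D : Set ℝ, (D = univ ∨ ∃ t, D = {t}) →
        IsPreconnected (F ∩ {x | ∀ j, j ≠ c → x j ∈ A j} ∩ {x | x c ∈ D}) := by
      intro D hD
      rw [← hupd]
      refine ih _ (fun j => ?_) fun j hj => ?_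
      · by_cases hjc : j = c
        · subst hjc
          rw [Function.update_self]
          exact hD.imp_right fun ⟨t, ht⟩ => ⟨t, Or.inr (Or.inl ht)⟩
        · rw [Function.update_of_ne hjc]; exact hA j
      · by_cases hjc : j = c
        · subst hjc
          rwa [Function.update_self]
        · rw [Function.update_of_ne hjc]; exact hAT j (by simp [hjc, hj])
    have huniv : IsPreconnected (F ∩ {x | ∀ j, j ≠ c → x j ∈ A j}) := by
      simpa using hpre univ (Or.inl rfl)
    have hsing : ∀ t, IsPreconnected (F ∩ {x | ∀ j, j ≠ c → x j ∈ A j} ∩ {x | x c = t}) :=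
      fun t => hpre {t} (Or.inr ⟨t, rfl⟩)
    have hself : F ∩ {x | ∀ j, x j ∈ A j} =
        F ∩ {x | ∀ j, j ≠ c → x j ∈ A j} ∩ {x | x c ∈ A c} := by
      rw [← hupd, Function.update_eq_self]
    rw [hself]
    rcases hA c with h | ⟨t, h | h | h⟩
    · exact hpre _ (Or.inl h)
    · rw [h]; exact huniv.inter_coord_lt c hsing t
    · rw [h]; exact hsing t
    · rw [h]; exact huniv.inter_coord_gt c hsing t

end Cones

/-! ### Sets represented by a matroid: bases, projections, level sets -/

/-- The matroid `M` governs the coordinates on `F`: closures are functional dependencies, and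
projections to independent coordinates are open. -/
structure Represents {κ : Type} (M : Matroid κ) (F : Set (κ → ℝ)) : Prop where
  nonempty : F.Nonempty
  slices : HasConnectedSlices F
  determines : ∀ I, ∀ e ∈ M.closure I, Determines F I e
  projectsOpenly : ∀ I, M.Indep I → ProjectsOpenly F I

namespace Represents

variable {κ : Type} {M : Matroid κ} {F : Set (κ → ℝ)}

/-- The geometry recovers the bases. Extend a basis `I` of `H` to a base `B`. A coordinate in `B \
I` could be moved with the rest of `B` fixed; this would fix `I`, hence `H`, contradicting that `H`
determines everything. So `I = B`, and counting gives `I = H`. -/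
theorem isBase_iff [Finite κ] (h : Represents M F) (hE : M.E = univ) {B₀ H : Set κ}
    (hB₀ : M.IsBase B₀) :
    M.IsBase H ↔ H.ncard = B₀.ncard ∧ ∀ e, Determines F H e := by
  constructor
  · intro hH
    exact ⟨hH.ncard_eq_ncard_of_isBase hB₀, fun e => h.determines H e (by
      rw [hH.closure_eq, hE]; trivial)⟩
  · rintro ⟨hcard, hdet⟩
    obtain ⟨I, hI⟩ := M.exists_isBasis H (by rw [hE]; exact subset_univ _)
    obtain ⟨B, hB, hIB⟩ := hI.indep.exists_isBase_superset
    have hBI : B ⊆ I := by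
      intro b hb
      by_contra hbI
      obtain ⟨z, hz⟩ := h.nonempty
      obtain ⟨w, hw, hne, heq⟩ := (h.projectsOpenly B hB.indep).exists_move hz hb
      refine hne (hdet b w hw z hz fun s hs => ?_)
      exact h.determines I s (hI.subset_closure hs) w hw z hz fun c hc =>
        heq c (hIB hc) (ne_of_mem_of_not_mem hc hbI)
    have hIB' := hIB.antisymm hBI
    subst hIB'
    have : I = H := eq_of_subset_of_ncard_le hI.subset
      (by rw [hcard, hB.ncard_eq_ncard_of_isBase hB₀]) H.toFinite
    rwa [← this]

theorem comap (h : Represents M F) {κ' : Type} {σ : κ' → κ} (hσ : σ.Injective) :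
    Represents (M.comap σ) ((fun z => z ∘ σ) '' F) where
  nonempty := h.nonempty.image _
  slices := by
    intro S z
    have hc : Continuous fun z : κ → ℝ => z ∘ σ := by fun_prop
    -- Only values on `σ '' S` are prescribed, so the default `0` of the extension plays no role.
    convert (h.slices (σ '' S) (Function.extend σ z 0)).image _ hc.continuousOn using 1
    ext w
    simp only [mem_inter_iff, mem_image, mem_ofPred_eq]
    constructor
    · rintro ⟨⟨v, hv, rfl⟩, hS⟩
      refine ⟨v, ⟨hv, ?_⟩, rfl⟩
      rintro _ ⟨s, hs, rfl⟩
      rw [hσ.extend_apply, ← hS s hs, Function.comp_apply]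
    · rintro ⟨v, ⟨hv, hS⟩, rfl⟩
      refine ⟨⟨v, hv, rfl⟩, fun s hs => ?_⟩
      rw [Function.comp_apply, hS _ ⟨s, hs, rfl⟩, hσ.extend_apply]
  determines := by
    intro I e he
    rw [Matroid.comap_closure_eq] at he
    rintro _ ⟨z, hz, rfl⟩ _ ⟨w, hw, rfl⟩ hzw
    refine h.determines _ _ he z hz w hw ?_
    rintro _ ⟨s, hs, rfl⟩
    exact hzw s hs
  projectsOpenly := by
    intro I hI
    rw [Matroid.comap_indep_iff] at hI
    rintro _ ⟨z, hz, rfl⟩ ε hε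
    obtain ⟨δ, hδ, H⟩ := h.projectsOpenly _ hI.1 z hz ε hε
    refine ⟨δ, hδ, fun y hy => ?_⟩
    obtain ⟨w, hw, hwy, hwz⟩ := H (Function.extend σ y 0) (by
      rintro _ ⟨s, hs, rfl⟩
      rw [hσ.extend_apply]
      exact hy s hs)
    refine ⟨_, ⟨w, hw, rfl⟩, fun b hb => ?_, fun c => hwz (σ c)⟩
    exact (hwy _ ⟨b, hb, rfl⟩).trans (hσ.extend_apply y 0 b)

/-- A set independent in the contraction stays independent in `M` after adding `e`, so it can be
moved while `e` is held at `b`. -/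
theorem contract (h : Represents M F) {e : κ} (he : M.IsNonloop e) {b : ℝ}
    (hne : (F ∩ {w | w e = b}).Nonempty) :
    Represents (M.contract {e}) (F ∩ {w | w e = b}) where
  nonempty := hne
  slices := by
    classical
    intro S z
    by_cases heS : e ∈ S ∧ z e ≠ b
    · convert isPreconnected_empty
      refine eq_empty_of_forall_notMem ?_
      rintro w ⟨⟨_, hwb : w e = b⟩, hw⟩
      exact heS.2 ((hw e heS.1).symm.trans hwb)
    · convert h.slices (insert e S) (Function.update z e b) using 1
      ext w
      simp only [mem_inter_iff, mem_ofPred_eq, forall_mem_insert, Function.update_self, and_assoc]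
      refine and_congr_right fun _ => and_congr_right fun hwe => forall₂_congr fun s hs => ?_
      by_cases hse : s = e
      · subst hse
        have : z s = b := by tauto
        simp [this]
      · simp [hse]
  determines := by
    intro I f hf
    rw [Matroid.contract_closure_eq] at hf
    rintro z ⟨hz, hzb : z e = b⟩ w ⟨hw, hwb : w e = b⟩ hzw
    refine h.determines _ _ hf.1 z hz w hw ?_
    rintro s (hs | hs)
    · exact hzw s hs
    · rw [mem_singleton_iff.1 hs, hzb, hwb]
  projectsOpenly := by
    classical
    intro I hI
    rw [he.contractElem_indep_iff] at hI
    rintro z ⟨hz, hzb : z e = b⟩ ε hε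
    obtain ⟨δ, hδ, H⟩ := h.projectsOpenly _ hI.2 z hz ε hε
    refine ⟨δ, hδ, fun y hy => ?_⟩
    obtain ⟨w, hw, hwy, hwz⟩ := H (Function.update y e b) (by
      rintro s (rfl | hs)
      · simpa [hzb] using hδ
      · rw [Function.update_of_ne (ne_of_mem_of_not_mem hs hI.1)]
        exact hy s hs)
    refine ⟨w, ⟨hw, ?_⟩, fun c hc => ?_, hwz⟩
    · simpa using hwy e (Or.inl rfl)
    · rw [hwy c (Or.inr hc), Function.update_of_ne (ne_of_mem_of_not_mem hc hI.1)]

end Represents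

/-! ### Charts and the construction of the matroid -/

/-- Bases of the matroid of `F`: sets of `n` coordinates that give an injective open projection. -/
structure IsChart {κ : Type} (F : Set (κ → ℝ)) (n : ℕ) (B : Set κ) : Prop where
  card : B.ncard = n
  determines : ∀ e, Determines F B e
  projectsOpenly : ProjectsOpenly F B

theorem IsChart.exchange {κ : Type} [Fintype κ] {F : Set (κ → ℝ)} {n : ℕ} {B : Set κ}
    (hB : IsChart F n B) {a e : κ} (ha : a ∈ B) (he : e ∉ B)
    (hinj : ∀ c, Determines F (insert e (B \ {a})) c) : IsChart F n (insert e (B \ {a})) where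
  card := by rw [ncard_exchange he ha, hB.card]
  determines := hinj
  projectsOpenly := hB.projectsOpenly.exchange hB.determines ha he hinj

/-- A set with an exchange dichotomy for its charts is represented by a matroid. -/
theorem exists_represents {κ : Type} [Fintype κ] {F : Set (κ → ℝ)} {n : ℕ} (hne : F.Nonempty)
    (hF : HasConnectedSlices F) (hex : ∃ B, IsChart F n B)
    (h : ∀ B, IsChart F n B → ∀ a ∈ B, ∀ e ∉ B,
      (∀ c, Determines F (insert e (B \ {a})) c) ∨ Determines F (B \ {a}) e) :
    ∃ M : Matroid κ, M.E = univ ∧ Represents M F ∧ ∃ B, M.IsBase B ∧ B.ncard = n := by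
  have hexch : Matroid.ExchangeProperty (IsChart F n) := by
    -- If no exchange for `a` works, the dichotomy makes every coordinate in `B' \ B` a function of
    -- `B \ {a}`. Moving `a` alone then fixes all of `B'`, which nevertheless determines `a`.
    intro B B' hB hB' a ha
    by_contra! hcon
    obtain ⟨z, hz⟩ := hne
    obtain ⟨w, hw, hwa, heq⟩ := hB.projectsOpenly.exists_move hz ha.1
    refine hwa (hB'.determines a w hw z hz fun s hs => ?_)
    by_cases hsB : s ∈ B
    · exact heq s hsB (ne_of_mem_of_not_mem hs ha.2)
    · have hs' := (h B hB a ha.1 s hsB).resolve_left fun h' =>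
        hcon s ⟨hs, hsB⟩ (hB.exchange ha.1 hsB h')
      exact hs' w hw z hz fun c hc => heq c hc.1 hc.2
  let M : Matroid κ := Matroid.ofIsBaseOfFinite (E := univ) finite_univ (IsChart F n) hex hexch
    fun _ _ => subset_univ _
  have hM : ∀ B, M.IsBase B ↔ IsChart F n B := fun B => by simp [M]
  have hE : M.E = univ := rfl
  refine ⟨M, hE, ⟨hne, hF, ?_, ?_⟩, ?_⟩
  · intro I e he
    obtain ⟨J, hJ⟩ := M.exists_isBasis I (by rw [hE]; exact subset_univ _)
    obtain ⟨B, hB, hJB⟩ := hJ.indep.exists_isBase_superset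
    have hBc := (hM B).1 hB
    rw [← hJ.closure_eq_closure] at he
    refine Determines.mono ?_ hJ.subset
    -- It suffices that `e` ignores each `b ∈ B \ J`. Otherwise the dichotomy gives a base
    -- containing `e` and `J`, against `e` being in the closure of `J`.
    refine determines_of_forall_diff_singleton hBc.projectsOpenly (fun S _ => hF S) hJB (hBc.determines e)
      fun b hb => ?_
    have hsub : J ⊆ B \ {b} := fun j hj => ⟨hJB hj, ne_of_mem_of_not_mem hj hb.2⟩
    by_cases heB : e ∈ B
    · refine Determines.of_mem ⟨heB, fun heb => ?_⟩
      rw [mem_singleton_iff] at heb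
      subst heb
      exact (hB.indep.notMem_closure_sdiff_of_mem heB) (M.closure_subset_closure hsub he)
    · refine (h B hBc b hb.1 e heB).resolve_left fun h' => ?_
      have h1 := (hM _).2 (hBc.exchange hb.1 heB h')
      have h2 := h1.indep.notMem_closure_sdiff_of_mem (mem_insert e _)
      rw [insert_sdiff_self_of_notMem (fun h3 => heB h3.1)] at h2
      exact h2 (M.closure_subset_closure hsub he)
  · intro I hI
    obtain ⟨B, hB, hIB⟩ := hI.exists_isBase_superset
    exact ((hM B).1 hB).projectsOpenly.mono hIB
  · obtain ⟨B, hB⟩ := hex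
    exact ⟨B, (hM B).2 hB, hB.card⟩

/-! ### Definability, semi-monotone projections and preimages of cones -/

section Definability

variable {L : FirstOrder.Language.{u, v}} [L.Structure ℝ] {κ : Type}

theorem definable_coord_eq (e : κ) (b : ℝ) :
    (univ : Set ℝ).Definable L {w : κ → ℝ | w e = b} :=
  (DefinableFun.proj L).ofPred_eq_const (mem_univ b)

theorem IsOMinimal.definable_coord_lt (hL : IsOMinimal L) (e : κ) (b : ℝ) :
    (univ : Set ℝ).Definable L {w : κ → ℝ | w e < b} := by
  have hF : (univ : Set ℝ).DefinableMap L (fun w : κ → ℝ => ![w e, b]) := by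
    intro i
    fin_cases i
    · exact DefinableFun.proj L
    · exact L.definableFun_const κ (mem_univ b)
  simpa using! hL.definable_lt.preimage_map hF

theorem IsOMinimal.definable_lt_coord (hL : IsOMinimal L) (e : κ) (b : ℝ) :
    (univ : Set ℝ).Definable L {w : κ → ℝ | b < w e} := by
  have hF : (univ : Set ℝ).DefinableMap L (fun w : κ → ℝ => ![b, w e]) := by
    intro i
    fin_cases i
    · exact L.definableFun_const κ (mem_univ b)
    · exact DefinableFun.proj L
  simpa using! hL.definable_lt.preimage_map hF

theorem isBounded_image_comp [Finite κ] {κ' : Type} [Finite κ'] {F : Set (κ → ℝ)}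
    (hF : Bornology.IsBounded F) (σ : κ' → κ) :
    Bornology.IsBounded ((fun z => z ∘ σ) '' F) := by
  cases nonempty_fintype κ
  cases nonempty_fintype κ'
  obtain ⟨C, hC⟩ := hF.exists_norm_le
  refine isBounded_iff_forall_norm_le.2 ⟨max C 0, ?_⟩
  rintro _ ⟨z, hz, rfl⟩
  exact (pi_norm_le_iff_of_nonneg (le_max_right _ _)).2 fun c =>
    (norm_le_pi_norm z _).trans ((hC z hz).trans (le_max_left _ _))

/-- The projection of a bounded definable set to a space of coordinates to which it projects openly
is semi-monotone if the preimages of cones are connected. -/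
theorem isSemiMonotone_image [Finite κ] {ι : Type} [Finite ι] {F : Set (κ → ℝ)} {σ : ι → κ}
    (hσ : σ.Injective) (hdef : (univ : Set ℝ).Definable L F) (hb : Bornology.IsBounded F)
    (hopen : ProjectsOpenly F (range σ))
    (hcone : ∀ C : Set (ι → ℝ), IsCoordinateCone C → IsPreconnected (F ∩ {w | w ∘ σ ∈ C})) :
    IsSemiMonotone L ((fun z => z ∘ σ) '' F) where
  definable := hdef.image_comp σ
  isBounded := isBounded_image_comp hb σ
  isOpen := by
    cases nonempty_fintype ι
    rw [Metric.isOpen_iff]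
    rintro _ ⟨z, hz, rfl⟩
    obtain ⟨δ, hδ, H⟩ := hopen z hz 1 one_pos
    refine ⟨δ, hδ, fun y hy => ?_⟩
    obtain ⟨w, hw, hwy, -⟩ := H (Function.extend σ y 0) (by
      rintro _ ⟨s, rfl⟩
      rw [hσ.extend_apply]
      exact (dist_le_pi_dist y (z ∘ σ) s).trans_lt hy)
    refine ⟨w, hw, funext fun s => ?_⟩
    exact (hwy _ ⟨s, rfl⟩).trans (hσ.extend_apply y 0 s)
  connected := by
    intro C hC
    have hc : Continuous fun z : κ → ℝ => z ∘ σ := by fun_prop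
    convert (hcone C hC).image _ hc.continuousOn using 1
    ext w
    constructor
    · rintro ⟨⟨z, hz, rfl⟩, hzC⟩
      exact ⟨z, ⟨hz, hzC⟩, rfl⟩
    · rintro ⟨z, ⟨hz, hzC⟩, rfl⟩
      exact ⟨⟨z, hz, rfl⟩, hzC⟩

end Definability

section Cones

variable {ι κ : Type}

theorem IsCoordinateCone.preimage {C : Set (ι → ℝ)} (hC : IsCoordinateCone C) {σ : ι → κ}
    (hσ : σ.Injective) : IsCoordinateCone {w : κ → ℝ | w ∘ σ ∈ C} := by
  obtain ⟨A, hA, rfl⟩ := hC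
  refine ⟨Function.extend σ A fun _ => univ, fun j => ?_, ?_⟩
  · by_cases hj : ∃ i, σ i = j
    · obtain ⟨i, rfl⟩ := hj
      rw [hσ.extend_apply]
      exact hA i
    · rw [Function.extend_apply' _ _ _ hj]
      exact Or.inl rfl
  · ext w
    constructor
    · intro h j
      by_cases hj : ∃ i, σ i = j
      · obtain ⟨i, rfl⟩ := hj
        rw [hσ.extend_apply]
        exact h i
      · rw [Function.extend_apply' _ _ _ hj]
        trivial
    · intro h i
      have := h (σ i)
      rwa [hσ.extend_apply] at this

theorem IsCoordinateCone.preimage_inter {C : Set (ι → ℝ)} (hC : IsCoordinateCone C) {σ : ι → κ}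
    (hσ : σ.Injective) {e : κ} (he : e ∉ range σ) {D : Set ℝ}
    (hD : ∃ c : ℝ, D = Iio c ∨ D = {c} ∨ D = Ioi c) :
    IsCoordinateCone ({w : κ → ℝ | w e ∈ D} ∩ {w | w ∘ σ ∈ C}) := by
  classical
  obtain ⟨A, hA, rfl⟩ := hC
  refine ⟨Function.update (Function.extend σ A fun _ => univ) e D, fun j => ?_, ?_⟩
  · by_cases hj : j = e
    · subst hj
      rw [Function.update_self]
      exact Or.inr hD
    · rw [Function.update_of_ne hj]
      by_cases hj : ∃ i, σ i = j
      · obtain ⟨i, rfl⟩ := hj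
        rw [hσ.extend_apply]
        exact hA i
      · rw [Function.extend_apply' _ _ _ hj]
        exact Or.inl rfl
  · ext w
    constructor
    · rintro ⟨hwe, hw⟩ j
      by_cases hj : j = e
      · subst hj
        rwa [Function.update_self]
      · rw [Function.update_of_ne hj]
        by_cases hj : ∃ i, σ i = j
        · obtain ⟨i, rfl⟩ := hj
          rw [hσ.extend_apply]
          exact hw i
        · rw [Function.extend_apply' _ _ _ hj]
          trivial
    · intro h
      refine ⟨by simpa using h e, fun i => ?_⟩
      have hi := h (σ i)
      rwa [Function.update_of_ne (fun hie => he ⟨i, hie⟩), hσ.extend_apply] at hi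

end Cones

theorem ProjectsOpenly.inter_isOpen {κ : Type} [Fintype κ] {F : Set (κ → ℝ)} {B : Set κ}
    (h : ProjectsOpenly F B) {U : Set (κ → ℝ)} (hU : IsOpen U) : ProjectsOpenly (F ∩ U) B := by
  rintro z ⟨hz, hzU⟩ ε hε
  obtain ⟨ε', hε', hball⟩ := Metric.isOpen_iff.1 hU z hzU
  obtain ⟨δ, hδ, H⟩ := h z hz (min ε ε') (lt_min hε hε')
  refine ⟨δ, hδ, fun y hy => ?_⟩
  obtain ⟨w, hw, hwy, hwz⟩ := H y hy
  refine ⟨w, ⟨hw, hball ?_⟩, hwy, fun c => (hwz c).trans_le (min_le_left _ _)⟩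
  exact (dist_pi_lt_iff hε').2 fun c => (hwz c).trans_le (min_le_right _ _)

/-- If both alternatives failed, the two pairs of witnesses would lie in one compact interval inside
`T`, where the dichotomy is known. -/
theorem strictMonoOn_or_strictAntiOn {T : Set ℝ} (hT : T.OrdConnected) {h : ℝ → ℝ}
    (hc : ContinuousOn h T) (hi : InjOn h T) : StrictMonoOn h T ∨ StrictAntiOn h T := by
  by_contra! hcon
  obtain ⟨h1, h2⟩ := hcon
  simp only [StrictMonoOn, StrictAntiOn, not_forall, not_lt] at h1 h2
  obtain ⟨x, hx, y, hy, hxy, hle⟩ := h1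
  obtain ⟨x', hx', y', hy', hxy', hle'⟩ := h2
  have hmin : min x x' ∈ T := by rcases min_choice x x' with h | h <;> rwa [h]
  have hmax : max y y' ∈ T := by rcases max_choice y y' with h | h <;> rwa [h]
  have hsub : Icc (min x x') (max y y') ⊆ T := hT.out hmin hmax
  have m1 : x ∈ Icc (min x x') (max y y') := ⟨min_le_left _ _, hxy.le.trans (le_max_left _ _)⟩
  have m2 : y ∈ Icc (min x x') (max y y') := ⟨(min_le_left _ _).trans hxy.le, le_max_left _ _⟩
  have m3 : x' ∈ Icc (min x x') (max y y') := ⟨min_le_right _ _, hxy'.le.trans (le_max_right _ _)⟩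
  have m4 : y' ∈ Icc (min x x') (max y y') := ⟨(min_le_right _ _).trans hxy'.le, le_max_right _ _⟩
  rcases (hc.mono hsub).strictMonoOn_of_injOn_Icc' (m1.1.trans m1.2) (hi.mono hsub) with H | H
  · exact absurd (H m1 m2 hxy) (not_lt.2 hle)
  · exact absurd (H m3 m4 hxy') (not_lt.2 hle')

/-! ### Graphs, basis sets and level sets -/

section Graph

theorem graphOf_proj {ι κ : Type} (Y : Set (ι → ℝ)) (g : (ι → ℝ) → κ → ℝ) :
    (fun z : ι ⊕ κ → ℝ => z ∘ Sum.inl) '' graphOf Y g = Y := by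
  ext y
  constructor
  · rintro ⟨_, ⟨x, hx, rfl⟩, rfl⟩
    simpa using hx
  · exact fun hy => ⟨_, ⟨y, hy, rfl⟩, by simp⟩

theorem elim_mem_graphOf {ι κ : Type} {Y : Set (ι → ℝ)} (g : (ι → ℝ) → κ → ℝ) {x : ι → ℝ}
    (hx : x ∈ Y) : Sum.elim x (g x) ∈ graphOf Y g :=
  ⟨x, hx, rfl⟩

theorem determines_inl_graphOf {ι κ : Type} (Y : Set (ι → ℝ)) (g : (ι → ℝ) → κ → ℝ) (e : ι ⊕ κ) :
    Determines (graphOf Y g) (range Sum.inl) e := by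
  rintro _ ⟨x, hx, rfl⟩ _ ⟨y, hy, rfl⟩ h
  have : x = y := funext fun j => h (Sum.inl j) ⟨j, rfl⟩
  rw [this]

theorem exists_eq_graphOf {ι κ : Type} {F : Set (ι ⊕ κ → ℝ)}
    (hF : ∀ e, Determines F (range Sum.inl) e) :
    ∃ (Y : Set (ι → ℝ)) (g : (ι → ℝ) → κ → ℝ), F = graphOf Y g := by
  classical
  choose! s hs using fun (y : ι → ℝ) (hy : y ∈ (fun z : ι ⊕ κ → ℝ => z ∘ Sum.inl) '' F) => hy
  refine ⟨(fun z => z ∘ Sum.inl) '' F, fun y => s y ∘ Sum.inr, ?_⟩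
  have key : ∀ z ∈ F, Sum.elim (z ∘ Sum.inl) (s (z ∘ Sum.inl) ∘ Sum.inr) = z := by
    intro z hz
    obtain ⟨h1, h2⟩ := hs (z ∘ Sum.inl) ⟨z, hz, rfl⟩
    have : s (z ∘ Sum.inl) = z := eq_of_determines hF h1 hz (by
      rintro _ ⟨j, rfl⟩
      exact congrFun h2 j)
    rw [this, Sum.elim_comp_inl_inr]
  ext z
  constructor
  · exact fun hz => ⟨z ∘ Sum.inl, ⟨z, hz, rfl⟩, key z hz⟩
  · rintro ⟨_, ⟨z', hz', rfl⟩, rfl⟩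
    have := key z' hz'
    simp only at this ⊢
    rwa [this]

theorem isBasisSet_iff {n k : ℕ} {X : Set (Fin n → ℝ)} {f : (Fin n → ℝ) → Fin k → ℝ}
    {H : Set (Fin n ⊕ Fin k)} :
    IsBasisSet X f H ↔ H.ncard = n ∧ ∀ e, Determines (graphOf X f) H e := by
  refine and_congr_right fun _ => ⟨fun h e => ?_, fun h x hx y hy hxy => ?_⟩
  · rintro _ ⟨x, hx, rfl⟩ _ ⟨y, hy, rfl⟩ hxy
    rw [h hx hy (funext fun s => hxy s s.2)]
  · have := eq_of_determines h (elim_mem_graphOf f hx) (elim_mem_graphOf f hy)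
      fun s hs => congrFun hxy ⟨s, hs⟩
    exact funext fun j => congrFun this (Sum.inl j)

theorem ncard_range_inl (n k : ℕ) : (range (Sum.inl : Fin n → Fin n ⊕ Fin k)).ncard = n := by
  rw [← image_univ, ncard_image_of_injective _ Sum.inl_injective]
  simp

theorem Represents.isBase_iff_isBasisSet {n k : ℕ} {X : Set (Fin n → ℝ)}
    {f : (Fin n → ℝ) → Fin k → ℝ} {M : Matroid (Fin n ⊕ Fin k)} (h : Represents M (graphOf X f))
    (hE : M.E = univ) (hB : M.IsBase (range Sum.inl)) (H : Set (Fin n ⊕ Fin k)) :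
    M.IsBase H ↔ IsBasisSet X f H := by
  rw [h.isBase_iff hE hB, isBasisSet_iff, ncard_range_inl]

/-- The relabelling of the coordinates of the level sets of `y i`. -/
def levelLabel {n k : ℕ} (i : Fin k) (j : Fin (n + 1)) : Fin n ⊕ Fin k → Fin (n + 1) ⊕ Fin k :=
  Sum.elim (fun a => Sum.inl (j.succAbove a)) fun l => if l = i then Sum.inl j else Sum.inr l

variable {n k : ℕ} (i : Fin k) (j : Fin (n + 1))

theorem levelLabel_injective : (levelLabel i j).Injective := by
  rintro (a | a) (b | b) h
  · simpa [levelLabel] using h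
  · simp only [levelLabel, Sum.elim_inl, Sum.elim_inr] at h
    split_ifs at h
    · exact absurd (Sum.inl_injective h) (Fin.succAbove_ne j a)
  · simp only [levelLabel, Sum.elim_inl, Sum.elim_inr] at h
    split_ifs at h
    · exact absurd (Sum.inl_injective h).symm (Fin.succAbove_ne j b)
  · simp only [levelLabel, Sum.elim_inr] at h
    split_ifs at h with h1 h2 h2
    · rw [h1, h2]
    · rw [Sum.inr_injective h]

theorem range_levelLabel : range (levelLabel i j) = {Sum.inr i}ᶜ := by
  ext c
  constructor
  · rintro ⟨a | l, rfl⟩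
    · simp [levelLabel]
    · by_cases h : l = i <;> simp [levelLabel, h]
  · intro hc
    rcases c with a | l
    · by_cases h : a = j
      · exact ⟨Sum.inr i, by simp [levelLabel, h]⟩
      · obtain ⟨a', rfl⟩ := Fin.exists_succAbove_eq h
        exact ⟨Sum.inl a', by simp [levelLabel]⟩
    · have h : l ≠ i := by simpa using hc
      exact ⟨Sum.inr l, by simp [levelLabel, h]⟩

theorem levelLabel_image_inl :
    levelLabel i j '' range Sum.inl = range Sum.inl \ {Sum.inl j} := by
  ext c
  constructor
  · rintro ⟨_, ⟨a, rfl⟩, rfl⟩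
    simp [levelLabel, Fin.succAbove_ne]
  · rintro ⟨⟨a, rfl⟩, ha⟩
    obtain ⟨a', rfl⟩ := Fin.exists_succAbove_eq (show a ≠ j by simpa using ha)
    exact ⟨_, ⟨a', rfl⟩, by simp [levelLabel]⟩

/-- A level set is a slice of the graph followed by a relabelling, so contraction and then `comap`
of the matroid apply to it. -/
theorem levelGraph_eq (X : Set (Fin (n + 1) → ℝ)) (f : (Fin (n + 1) → ℝ) → Fin k → ℝ) (b : ℝ) :
    levelGraph X f i j b =
      (fun z => z ∘ levelLabel i j) '' (graphOf X f ∩ {w | w (Sum.inr i) = b}) := by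
  have key : ∀ x, Sum.elim x (f x) ∘ levelLabel i j =
      Sum.elim (j.removeNth x) (Function.update (f x) i (x j)) := by
    intro x
    funext c
    rcases c with a | l
    · simp [levelLabel, Fin.removeNth]
    · by_cases h : l = i
      · subst h
        simp [levelLabel]
      · simp [levelLabel, h]
  ext w
  constructor
  · rintro ⟨x, ⟨hx, hxb⟩, rfl⟩
    exact ⟨_, ⟨elim_mem_graphOf f hx, hxb⟩, key x⟩
  · rintro ⟨_, ⟨⟨x, hx, rfl⟩, hxb⟩, rfl⟩
    exact ⟨x, ⟨hx, hxb⟩, (key x).symm⟩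

end Graph

/-! ### Represented graphs are monotone maps -/

section OfRepresents

variable {L : FirstOrder.Language.{u, v}} [L.Structure ℝ]

/-- Projections to independent coordinates are semi-monotone. -/
theorem Represents.isSemiMonotone_image {κ ι : Type} [Fintype κ] [Finite ι] {M : Matroid κ}
    {F : Set (κ → ℝ)} (h : Represents M F) {σ : ι → κ} (hσ : σ.Injective)
    (hI : M.Indep (range σ)) (hdef : (univ : Set ℝ).Definable L F) (hb : Bornology.IsBounded F) :
    IsSemiMonotone L ((fun z => z ∘ σ) '' F) :=
  _root_.isSemiMonotone_image hσ hdef hb (h.projectsOpenly _ hI)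
    fun _ hC => h.slices.inter_cone (hC.preimage hσ)

/-- A cone in the coordinates of `σ` together with the inequality on `e` is again a cone. This gives
the sublevel and superlevel sets of the components. -/
theorem Represents.isSemiMonotone_image_inter {κ ι : Type} [Fintype κ] [Finite ι] {M : Matroid κ}
    {F : Set (κ → ℝ)} (h : Represents M F) {σ : ι → κ} (hσ : σ.Injective)
    (hI : M.Indep (range σ)) {e : κ} (he : e ∉ range σ) {D : Set ℝ} (hD : ∃ c, D = Iio c ∨ D = Ioi c)
    (hdef : (univ : Set ℝ).Definable L (F ∩ {w | w e ∈ D})) (hb : Bornology.IsBounded F) :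
    IsSemiMonotone L ((fun z => z ∘ σ) '' (F ∩ {w | w e ∈ D})) := by
  have hDo : IsOpen D := by
    rcases hD with ⟨c, rfl | rfl⟩
    · exact isOpen_Iio
    · exact isOpen_Ioi
  refine _root_.isSemiMonotone_image hσ hdef (hb.subset inter_subset_left)
    ((h.projectsOpenly _ hI).inter_isOpen (hDo.preimage (continuous_apply e))) fun C hC => ?_
  rw [inter_assoc]
  exact h.slices.inter_cone (hC.preimage_inter hσ he (hD.imp fun c => Or.imp_right Or.inr))

theorem isDefinableMap_coord {p q : ℕ} {Y : Set (Fin p → ℝ)} {g : (Fin p → ℝ) → Fin q → ℝ}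
    (hdef : (univ : Set ℝ).Definable L (graphOf Y g)) (i : Fin q) :
    IsDefinableMap L Y (fun x (_ : Unit) => g x i) := by
  have := hdef.image_comp (Sum.map id fun _ : Unit => i)
  unfold IsDefinableMap
  convert this using 1
  rw [graphOf, graphOf, image_image]
  refine image_congr fun x _ => ?_
  ext (c | c) <;> simp

section

variable {p q : ℕ} {M : Matroid (Fin p ⊕ Fin q)} {Y : Set (Fin p → ℝ)}
  {g : (Fin p → ℝ) → Fin q → ℝ}

theorem Represents.continuousOn (h : Represents M (graphOf Y g)) (hB : M.IsBase (range Sum.inl)) :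
    ContinuousOn g Y := by
  have hW : ContinuousOn (fun w : Fin p ⊕ Fin q → ℝ => Sum.elim (w ∘ Sum.inl) (g (w ∘ Sum.inl)))
      {w | w ∘ Sum.inl ∈ Y} := by
    refine continuousOn_of_section (h.projectsOpenly _ hB.indep) (determines_inl_graphOf Y g) ?_
    intro w hw
    refine ⟨elim_mem_graphOf g hw, ?_⟩
    rintro _ ⟨j, rfl⟩
    rfl
  -- Sections live on the full coordinate space, so `x` is padded by `0` in the target coordinates.
  have h0 : Continuous fun x : Fin p → ℝ => (Sum.elim x 0 : Fin p ⊕ Fin q → ℝ) := by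
    refine continuous_pi fun c => ?_
    rcases c with c | c
    · exact continuous_apply c
    · exact continuous_const
  have h1 : Continuous fun w : Fin p ⊕ Fin q → ℝ => w ∘ Sum.inr := by fun_prop
  exact h1.comp_continuousOn (hW.comp h0.continuousOn fun x hx => by simpa using hx)

variable (h : Represents M (graphOf Y g)) (hB : M.IsBase (range Sum.inl))
  (hdef : (univ : Set ℝ).Definable L (graphOf Y g)) (hb : Bornology.IsBounded (graphOf Y g))

include h

theorem Represents.nonempty_domain : Y.Nonempty := by
  obtain ⟨_, x, hx, -⟩ := h.nonempty
  exact ⟨x, hx⟩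

include hB hdef hb

theorem Represents.isSemiMonotone_domain : IsSemiMonotone L Y := by
  rw [← graphOf_proj Y g]
  exact h.isSemiMonotone_image Sum.inl_injective hB.indep hdef hb

theorem Represents.isBoundedContinuousMap (hq : 1 ≤ q) : IsBoundedContinuousMap L Y g where
  one_le := hq
  nonempty := h.nonempty_domain
  semiMonotone := h.isSemiMonotone_domain hB hdef hb
  definable := hdef
  continuousOn := h.continuousOn hB
  bounded := by
    convert isBounded_image_comp hb Sum.inr using 1
    rw [graphOf, image_image]
    simp

theorem Represents.isSubmonotone (hL : IsOMinimal L) (i : Fin q) :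
    IsSubmonotone L Y (fun x => g x i) ∧ IsSupermonotone L Y (fun x => g x i) := by
  have hcont : ContinuousOn (fun x => g x i) Y :=
    (continuous_apply i).comp_continuousOn (h.continuousOn hB)
  have hbd : Bornology.IsBounded ((fun x => g x i) '' Y) := by
    have h1 := isBounded_image_comp hb Sum.inr
    rw [graphOf, image_image] at h1
    obtain ⟨C, hC⟩ := h1.exists_norm_le
    refine isBounded_iff_forall_norm_le.2 ⟨C, ?_⟩
    rintro _ ⟨x, hx, rfl⟩
    exact (norm_le_pi_norm (g x) i).trans (hC _ ⟨x, hx, by simp⟩)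
  have himg : ∀ D : Set ℝ, (fun z : Fin p ⊕ Fin q → ℝ => z ∘ Sum.inl) ''
      (graphOf Y g ∩ {w | w (Sum.inr i) ∈ D}) = {x ∈ Y | g x i ∈ D} := by
    intro D
    ext y
    constructor
    · rintro ⟨_, ⟨⟨x, hx, rfl⟩, hD⟩, rfl⟩
      exact ⟨by simpa using hx, by simpa using hD⟩
    · rintro ⟨hy, hD⟩
      exact ⟨_, ⟨elim_mem_graphOf g hy, hD⟩, by simp⟩
  have hi : (Sum.inr i : Fin p ⊕ Fin q) ∉ range Sum.inl := by simp
  refine ⟨⟨h.nonempty_domain, h.isSemiMonotone_domain hB hdef hb, hbd,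
    hcont.upperSemicontinuousOn, fun b => ?_⟩, ⟨h.nonempty_domain,
    h.isSemiMonotone_domain hB hdef hb, ?_, hcont.neg.upperSemicontinuousOn, fun b => ?_⟩⟩
  · have := h.isSemiMonotone_image_inter (L := L) Sum.inl_injective hB.indep hi (D := Iio b)
      ⟨b, Or.inl rfl⟩ (hdef.inter (hL.definable_coord_lt _ b)) hb
    rwa [himg] at this
  · rw [← image_image (fun t : ℝ => -t), image_neg_eq_neg]
    exact hbd.neg
  · have := h.isSemiMonotone_image_inter (L := L) Sum.inl_injective hB.indep hi (D := Ioi (-b))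
      ⟨-b, Or.inr rfl⟩ (hdef.inter (hL.definable_lt_coord _ (-b))) hb
    rw [himg] at this
    convert this using 1
    ext x
    exact and_congr_right fun _ => neg_lt (a := g x i) (b := b)

end

/-- In dimension one, removing `x j` empties the base. Either `y i` is a loop and the component is
constant, or `y i` alone is a base and the component is continuous and injective on an interval. -/
theorem Represents.isMonotoneFunction (hL : IsOMinimal L) {q : ℕ} {M : Matroid (Fin 1 ⊕ Fin q)}
    {Y : Set (Fin 1 → ℝ)} {g : (Fin 1 → ℝ) → Fin q → ℝ} (hE : M.E = univ)
    (h : Represents M (graphOf Y g))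
    (hB : M.IsBase (range Sum.inl)) (hdef : (univ : Set ℝ).Definable L (graphOf Y g))
    (hb : Bornology.IsBounded (graphOf Y g)) (i : Fin q) :
    IsMonotoneFunction L Y (fun x => g x i) where
  definable := isDefinableMap_coord hdef i
  submonotone := (h.isSubmonotone hB hdef hb hL i).1
  supermonotone := (h.isSubmonotone hB hdef hb hL i).2
  coordinate := by
    intro j
    have hx : ∀ x : Fin 1 → ℝ, (fun _ => x j) = x := fun x => funext fun a => by
      rw [Subsingleton.elim a j]
    have hmem : ∀ x ∈ Y, x j ∈ {t : ℝ | (fun _ => t) ∈ Y} := fun x hxY => by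
      rw [mem_ofPred_eq, hx]; exact hxY
    by_cases he : Sum.inr i ∈ M.closure (range Sum.inl \ {Sum.inl j})
    · right; right
      intro x hxY y hy hxy
      refine h.determines _ _ he _ (elim_mem_graphOf g hxY) _ (elim_mem_graphOf g hy) ?_
      rintro _ ⟨⟨a, rfl⟩, ha⟩
      exact absurd (by rw [Subsingleton.elim a j]; rfl) ha
    · have hbase := hB.exchange_base_of_notMem_closure (mem_range_self j) he (by rw [hE]; trivial)
      have hdet := h.determines _ (Sum.inl j) (by rw [hbase.closure_eq, hE]; trivial)
      have hT : IsPreconnected {t : ℝ | (fun _ => t) ∈ Y} := by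
        have h1 : IsPreconnected Y := by
          have := (h.isSemiMonotone_domain hB hdef hb).connected univ
            ⟨fun _ => univ, fun _ => Or.inl rfl, by simp⟩
          rwa [inter_univ] at this
        convert h1.image (fun x => x j) (continuous_apply j).continuousOn using 1
        ext t
        exact ⟨fun ht => ⟨_, ht, rfl⟩, by rintro ⟨x, hxY, rfl⟩; exact hmem x hxY⟩
      have hc : ContinuousOn (fun t : ℝ => g (fun _ => t) i) {t : ℝ | (fun _ => t) ∈ Y} :=
        ((continuous_apply i).comp_continuousOn (h.continuousOn hB)).comp
          (by fun_prop) fun t ht => ht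
      have hi : InjOn (fun t : ℝ => g (fun _ => t) i) {t : ℝ | (fun _ => t) ∈ Y} := by
        intro s hs t ht hst
        refine hdet _ (elim_mem_graphOf g hs) _ (elim_mem_graphOf g ht) ?_
        rintro _ (rfl | ⟨⟨a, rfl⟩, ha⟩)
        · exact hst
        · exact absurd (by rw [Subsingleton.elim a j]; rfl) ha
      rcases strictMonoOn_or_strictAntiOn hT.ordConnected hc hi with hm | hm
      · left
        intro x hxY y hy _ hxy
        have := hm (hmem x hxY) (hmem y hy) hxy
        simpa only [hx] using this
      · right; left
        intro x hxY y hy _ hxy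
        have := hm (hmem x hxY) (hmem y hy) hxy
        simpa only [hx] using this

/-- The matroid of the level sets of `y i`. -/
def levelMatroid {n k : ℕ} (M : Matroid (Fin (n + 1) ⊕ Fin k)) (i : Fin k) (j : Fin (n + 1)) :
    Matroid (Fin n ⊕ Fin k) :=
  (M.contract {Sum.inr i}).comap (levelLabel i j)

theorem levelMatroid_ground {n k : ℕ} {M : Matroid (Fin (n + 1) ⊕ Fin k)} (hE : M.E = univ)
    (i : Fin k) (j : Fin (n + 1)) : (levelMatroid M i j).E = univ := by
  rw [levelMatroid, Matroid.comap_ground_eq, Matroid.contract_ground, hE, eq_univ_iff_forall]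
  intro c
  have := range_levelLabel i j ▸ mem_range_self c
  exact ⟨trivial, this⟩

theorem levelMatroid_isBase {n k : ℕ} {M : Matroid (Fin (n + 1) ⊕ Fin k)} (hE : M.E = univ)
    {i : Fin k} {j : Fin (n + 1)}
    (hB : M.IsBase (insert (Sum.inr i) (range Sum.inl \ {Sum.inl j}))) :
    (levelMatroid M i j).IsBase (range Sum.inl) := by
  have he : M.Indep {Sum.inr i} := hB.indep.subset (by simp)
  have h1 : (M.contract {Sum.inr i}).IsBase (range Sum.inl \ {Sum.inl j}) := by
    rw [he.contract_isBase_iff, union_singleton]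
    exact ⟨hB, by simp⟩
  rw [Matroid.isBase_iff_indep_closure_eq, levelMatroid_ground hE, levelMatroid,
    Matroid.comap_indep_iff, Matroid.comap_closure_eq, levelLabel_image_inl]
  refine ⟨⟨h1.indep, (levelLabel_injective i j).injOn⟩, ?_⟩
  rw [h1.closure_eq]
  exact levelMatroid_ground hE i j

/-- Every nonempty level set is represented by the same `levelMatroid M i j`, which does not mention
`b`. Induction thus gives condition (i), and condition (ii) holds because the basis sets are the
bases of that matroid. -/
theorem Represents.isMonotoneMap (hL : IsOMinimal L) {q : ℕ} (hq : 1 ≤ q) :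
    ∀ (p : ℕ) (M : Matroid (Fin p ⊕ Fin q)) (Y : Set (Fin p → ℝ)) (g : (Fin p → ℝ) → Fin q → ℝ),
      M.E = univ → Represents M (graphOf Y g) → M.IsBase (range Sum.inl) →
      (univ : Set ℝ).Definable L (graphOf Y g) → Bornology.IsBounded (graphOf Y g) →
      IsMonotoneMap L p Y g := by
  intro p
  induction p with
  | zero =>
    intro M Y g hE h hB hdef hb
    exact h.isBoundedContinuousMap hB hdef hb hq
  | succ p ih =>
    cases p with
    | zero =>
      intro M Y g hE h hB hdef hb
      exact ⟨h.isBoundedContinuousMap hB hdef hb hq, h.isMonotoneFunction hL hE hB hdef hb⟩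
    | succ p =>
      intro M Y g hE h hB hdef hb
      refine ⟨h.isBoundedContinuousMap hB hdef hb hq, fun i j hij => ?_⟩
      -- Since the component depends on `x j`, the coordinate `y i` can replace `x j` in the base of
      -- domain coordinates.
      have he : Sum.inr i ∉ M.closure (range Sum.inl \ {Sum.inl j}) := by
        intro he
        refine hij fun x hx y hy hxy => ?_
        refine h.determines _ _ he _ (elim_mem_graphOf g hx) _ (elim_mem_graphOf g hy) ?_
        rintro _ ⟨⟨a, rfl⟩, ha⟩
        exact hxy a (by simpa using ha)
      have hB' := hB.exchange_base_of_notMem_closure (mem_range_self j) he (by rw [hE]; trivial)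
      have hnl : M.IsNonloop (Sum.inr i) := hB'.indep.isNonloop_of_mem (mem_insert _ _)
      have hNE := levelMatroid_ground hE i j
      have hNB := levelMatroid_isBase hE hB'
      have hrep : ∀ b, (levelGraph Y g i j b).Nonempty →
          Represents (levelMatroid M i j) (levelGraph Y g i j b) := by
        intro b hne
        rw [levelGraph_eq] at hne ⊢
        exact (h.contract hnl (image_nonempty.1 hne)).comap (levelLabel_injective i j)
      have hdet : ∀ b e, Determines (levelGraph Y g i j b) (range Sum.inl) e := by
        intro b e
        by_cases hne : (levelGraph Y g i j b).Nonempty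
        · exact (hrep b hne).determines _ e (by rw [hNB.closure_eq, hNE]; trivial)
        · exact fun z hz => absurd ⟨z, hz⟩ hne
      choose Z r hZ using fun b => exists_eq_graphOf (hdet b)
      refine ⟨Z, r, fun b hne => ⟨hZ b, ?_⟩, fun b b' hne hne' H => ?_⟩
      · refine ih _ _ _ hNE (hZ b ▸ hrep b hne) hNB ?_ ?_
        · rw [← hZ b, levelGraph_eq]
          exact (hdef.inter (definable_coord_eq _ b)).image_comp _
        · rw [← hZ b, levelGraph_eq]
          exact isBounded_image_comp (hb.subset inter_subset_left) _
      · rw [← (hZ b ▸ hrep b hne : Represents _ (graphOf (Z b) (r b))).isBase_iff_isBasisSet hNE hNB,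
          ← (hZ b' ▸ hrep b' hne' : Represents _ (graphOf (Z b') (r b'))).isBase_iff_isBasisSet
            hNE hNB]

end OfRepresents

/-! ### Graphs of monotone maps are represented by a matroid -/

variable {L : FirstOrder.Language.{u, v}} [L.Structure ℝ]

section OneBlock

variable {n k : ℕ} {X : Set (Fin n → ℝ)} {f : (Fin n → ℝ) → Fin k → ℝ}

theorem IsBoundedContinuousMap.isChart (h : IsBoundedContinuousMap L X f) :
    IsChart (graphOf X f) n (range Sum.inl) where
  card := ncard_range_inl n k
  determines := determines_inl_graphOf X f
  projectsOpenly := by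
    rintro _ ⟨x, hx, rfl⟩ ε hε
    obtain ⟨δ₁, hδ₁, h₁⟩ := Metric.isOpen_iff.1 h.semiMonotone.isOpen x hx
    obtain ⟨δ₂, hδ₂, h₂⟩ := Metric.continuousOn_iff.1 h.continuousOn x hx ε hε
    refine ⟨min ε (min δ₁ δ₂), by positivity, fun y hy => ?_⟩
    have hd : ∀ r > 0, min ε (min δ₁ δ₂) ≤ r → dist (y ∘ Sum.inl) x < r := fun r hr hle =>
      (dist_pi_lt_iff hr).2 fun j => (hy (Sum.inl j) ⟨j, rfl⟩).trans_le hle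
    have hyX : y ∘ Sum.inl ∈ X := h₁ (hd δ₁ hδ₁ ((min_le_right _ _).trans (min_le_left _ _)))
    refine ⟨_, elim_mem_graphOf f hyX, ?_, ?_⟩
    · rintro _ ⟨j, rfl⟩
      rfl
    · rintro (j | i)
      · exact (hy (Sum.inl j) ⟨j, rfl⟩).trans_le (min_le_left _ _)
      · exact (dist_pi_lt_iff hε).1
          (h₂ _ hyX (hd δ₂ hδ₂ ((min_le_right _ _).trans (min_le_right _ _)))) i

/-- Fixing domain coordinates cuts `X` by a coordinate cone, and the slice is the continuous image
of the result. -/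
theorem IsBoundedContinuousMap.isPreconnected_slice (h : IsBoundedContinuousMap L X f)
    {S : Set (Fin n ⊕ Fin k)} (hS : S ⊆ range Sum.inl) (z : Fin n ⊕ Fin k → ℝ) :
    IsPreconnected (graphOf X f ∩ {w | ∀ s ∈ S, w s = z s}) := by
  classical
  have hcone : IsCoordinateCone {x : Fin n → ℝ | ∀ j, Sum.inl j ∈ S → x j = z (Sum.inl j)} := by
    refine ⟨fun j => if Sum.inl j ∈ S then {z (Sum.inl j)} else univ, fun j => ?_, ?_⟩
    · by_cases hj : Sum.inl j ∈ S
      · exact Or.inr ⟨z (Sum.inl j), by simp [hj]⟩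
      · exact Or.inl (by simp [hj])
    · ext x
      refine forall_congr' fun j => ?_
      by_cases hj : Sum.inl j ∈ S <;> simp [hj]
  have hc : ContinuousOn (fun x => (Sum.elim x (f x) : Fin n ⊕ Fin k → ℝ)) X := by
    refine continuousOn_pi.2 fun c => ?_
    rcases c with j | i
    · exact (continuous_apply j).continuousOn
    · exact (continuous_apply i).comp_continuousOn h.continuousOn
  convert (h.semiMonotone.connected _ hcone).image _ (hc.mono inter_subset_left) using 1
  ext w
  constructor
  · rintro ⟨⟨x, hx, rfl⟩, hw⟩
    exact ⟨x, ⟨hx, fun j hj => hw _ hj⟩, rfl⟩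
  · rintro ⟨x, ⟨hx, hw⟩, rfl⟩
    refine ⟨⟨x, hx, rfl⟩, fun s hs => ?_⟩
    obtain ⟨j, rfl⟩ := hS hs
    exact hw j hs

theorem determines_of_independentOf {i : Fin k} {j : Fin n}
    (h : IndependentOf X (fun x => f x i) j) :
    Determines (graphOf X f) (range Sum.inl \ {Sum.inl j}) (Sum.inr i) := by
  rintro _ ⟨x, hx, rfl⟩ _ ⟨y, hy, rfl⟩ hxy
  exact h x hx y hy fun a ha => hxy (Sum.inl a) ⟨⟨a, rfl⟩, by simpa using ha⟩

/-- A component that is not constant depends on some coordinate. -/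
theorem IsBoundedContinuousMap.exists_not_independentOf (h : IsBoundedContinuousMap L X f)
    {i : Fin k} (hi : ¬ Determines (graphOf X f) ∅ (Sum.inr i)) :
    ∃ j, ¬ IndependentOf X (fun x => f x i) j := by
  by_contra! hcon
  refine hi (determines_of_forall_diff_singleton h.isChart.projectsOpenly
    (fun S hS => h.isPreconnected_slice hS) (empty_subset _) (h.isChart.determines _) ?_)
  rintro _ ⟨⟨j, rfl⟩, -⟩
  exact determines_of_independentOf (hcon j)

/-- A slice that fixes a nonconstant component lies in a level set. If all fixed components are
constant, the slice is empty or only its conditions on domain coordinates matter. -/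
theorem IsBoundedContinuousMap.hasConnectedSlices (h : IsBoundedContinuousMap L X f)
    (hlev : ∀ i j, ¬ IndependentOf X (fun x => f x i) j →
      ∀ (S : Set (Fin n ⊕ Fin k)) (z : Fin n ⊕ Fin k → ℝ), Sum.inr i ∈ S →
      IsPreconnected (graphOf X f ∩ {w | ∀ s ∈ S, w s = z s})) :
    HasConnectedSlices (graphOf X f) := by
  intro S z
  by_cases hex : ∃ i, Sum.inr i ∈ S ∧ ¬ Determines (graphOf X f) ∅ (Sum.inr i)
  · obtain ⟨i, hiS, hi⟩ := hex
    obtain ⟨j, hj⟩ := h.exists_not_independentOf hi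
    exact hlev i j hj S z hiS
  · push Not at hex
    rcases (graphOf X f ∩ {w | ∀ s ∈ S, w s = z s}).eq_empty_or_nonempty with he | ⟨v, hv, hvS⟩
    · rw [he]
      exact isPreconnected_empty
    · convert h.isPreconnected_slice (inter_subset_right : S ∩ range Sum.inl ⊆ _) z using 1
      ext w
      refine and_congr_right fun hw => ⟨fun H s hs => H s hs.1, fun H s hs => ?_⟩
      rcases s with j | i
      · exact H _ ⟨hs, mem_range_self j⟩
      · rw [hex i hs w hw v hv (by simp), hvS _ hs]

end OneBlock

section Dichotomy

variable {n k : ℕ} {X : Set (Fin (n + 1) → ℝ)} {f : (Fin (n + 1) → ℝ) → Fin k → ℝ}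

/-- The exchange dichotomy for all charts follows from the dichotomies for the initial chart and
those for exchanges that keep some target coordinate. -/
theorem chart_dichotomy
    (hinl : ∀ i j, ¬ IndependentOf X (fun x => f x i) j →
      ∀ c, Determines (graphOf X f) (insert (Sum.inr i) (range Sum.inl \ {Sum.inl j})) c)
    (hlev : ∀ i, ∀ B, IsChart (graphOf X f) (n + 1) B → Sum.inr i ∈ B → ∀ a ∈ B, a ≠ Sum.inr i →
      ∀ e ∉ B, (∀ c, Determines (graphOf X f) (insert e (B \ {a})) c) ∨
        Determines (graphOf X f) (B \ {a}) e)
    (B : Set (Fin (n + 1) ⊕ Fin k)) (hB : IsChart (graphOf X f) (n + 1) B)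
    (a : Fin (n + 1) ⊕ Fin k) (ha : a ∈ B) (e : Fin (n + 1) ⊕ Fin k) (he : e ∉ B) :
    (∀ c, Determines (graphOf X f) (insert e (B \ {a})) c) ∨
      Determines (graphOf X f) (B \ {a}) e := by
  by_cases hex : ∃ i, Sum.inr i ∈ B ∧ a ≠ Sum.inr i
  · obtain ⟨i, hiB, hia⟩ := hex
    exact hlev i B hB hiB a ha hia e he
  -- Here `a` is the only possible target coordinate in `B`, so `B \ {a}` consists of all domain
  -- coordinates but one.
  · push Not at hex
    have hsub : B \ {a} ⊆ range Sum.inl := by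
      rintro (j | i) ⟨hc, hca⟩
      · exact mem_range_self j
      · exact absurd (hex i hc).symm hca
    have hcard : (range Sum.inl \ (B \ {a})).ncard = 1 := by
      rw [ncard_sdiff hsub (toFinite _), ncard_range_inl, ncard_sdiff_singleton_of_mem ha, hB.card]
      omega
    obtain ⟨c, hc⟩ := ncard_eq_one.1 hcard
    obtain ⟨⟨j, rfl⟩, -⟩ : c ∈ range Sum.inl \ (B \ {a}) := hc ▸ mem_singleton c
    have hBa : B \ {a} = range Sum.inl \ {Sum.inl j} := by
      rw [← hc, sdiff_sdiff_cancel_left hsub]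
    rw [hBa]
    rcases e with j' | i
    · have hj' : (Sum.inl j' : Fin (n + 1) ⊕ Fin k) ∈ range Sum.inl \ (B \ {a}) :=
        ⟨mem_range_self j', fun h => he h.1⟩
      rw [hc, mem_singleton_iff] at hj'
      rw [hj', insert_sdiff_singleton, insert_eq_of_mem (mem_range_self j)]
      exact Or.inl (determines_inl_graphOf X f)
    · by_cases hi : IndependentOf X (fun x => f x i) j
      · exact Or.inr (determines_of_independentOf hi)
      · exact Or.inl (hinl i j hi)

/-- Points agreeing on a set that contains `y i` share a level, so dependence may be checked level
by level. -/
theorem determines_of_level {i : Fin k} {j : Fin (n + 1)} {S : Set (Fin n ⊕ Fin k)}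
    {T : Set (Fin (n + 1) ⊕ Fin k)} (hi : Sum.inr i ∈ T) (hST : levelLabel i j '' S ⊆ T)
    {e : Fin n ⊕ Fin k}
    (h : ∀ b, (levelGraph X f i j b).Nonempty → Determines (levelGraph X f i j b) S e) :
    Determines (graphOf X f) T (levelLabel i j e) := by
  intro z hz w hw hzw
  have hmem : ∀ v ∈ graphOf X f, v (Sum.inr i) = z (Sum.inr i) →
      v ∘ levelLabel i j ∈ levelGraph X f i j (z (Sum.inr i)) := by
    intro v hv hvz
    rw [levelGraph_eq]
    exact ⟨v, ⟨hv, hvz⟩, rfl⟩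
  exact h _ ⟨_, hmem z hz rfl⟩ _ (hmem z hz rfl) _ (hmem w hw (hzw _ hi).symm)
    fun s hs => hzw _ (hST ⟨s, hs, rfl⟩)

theorem determines_all_of_level {i : Fin k} {j : Fin (n + 1)} {S : Set (Fin n ⊕ Fin k)}
    {T : Set (Fin (n + 1) ⊕ Fin k)} (hi : Sum.inr i ∈ T) (hST : levelLabel i j '' S ⊆ T)
    (h : ∀ b, (levelGraph X f i j b).Nonempty → ∀ e, Determines (levelGraph X f i j b) S e)
    (c : Fin (n + 1) ⊕ Fin k) : Determines (graphOf X f) T c := by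
  by_cases hc : c = Sum.inr i
  · exact Determines.of_mem (hc ▸ hi)
  · obtain ⟨e, rfl⟩ : c ∈ range (levelLabel i j) := by
      rw [range_levelLabel]
      exact hc
    exact determines_of_level hi hST fun b hb => h b hb e

theorem determines_level {i : Fin k} {j : Fin (n + 1)} {T : Set (Fin (n + 1) ⊕ Fin k)}
    {e : Fin n ⊕ Fin k} (h : Determines (graphOf X f) T (levelLabel i j e)) (b : ℝ) :
    Determines (levelGraph X f i j b) (levelLabel i j ⁻¹' T) e := by
  rw [levelGraph_eq]
  rintro _ ⟨z, ⟨hz, hzb : z (Sum.inr i) = b⟩, rfl⟩ _ ⟨w, ⟨hw, hwb : w (Sum.inr i) = b⟩, rfl⟩ hzw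
  refine h z hz w hw fun s hs => ?_
  by_cases hsi : s = Sum.inr i
  · rw [hsi, hzb, hwb]
  · obtain ⟨s, rfl⟩ : s ∈ range (levelLabel i j) := by
      rw [range_levelLabel]
      exact hsi
    exact hzw s hs

theorem isPreconnected_slice_of_level {i : Fin k} {j : Fin (n + 1)}
    {S : Set (Fin (n + 1) ⊕ Fin k)} (hi : Sum.inr i ∈ S) (z : Fin (n + 1) ⊕ Fin k → ℝ)
    (h : HasConnectedSlices (levelGraph X f i j (z (Sum.inr i)))) :
    IsPreconnected (graphOf X f ∩ {w | ∀ s ∈ S, w s = z s}) := by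
  classical
  have hσ := levelLabel_injective i j
  -- `τ` undoes the relabelling on this level: the only coordinate missing is `y i`, whose value is
  -- `z (Sum.inr i)`.
  let τ : (Fin n ⊕ Fin k → ℝ) → Fin (n + 1) ⊕ Fin k → ℝ := fun v =>
    Function.extend (levelLabel i j) v z
  have hτ : Continuous τ := by
    refine continuous_pi fun c => ?_
    by_cases hc : ∃ a, levelLabel i j a = c
    · obtain ⟨a, rfl⟩ := hc
      simpa only [τ, hσ.extend_apply] using continuous_apply a
    · simpa only [τ, Function.extend_apply' _ _ _ hc] using continuous_const
  have hni : ¬ ∃ a, levelLabel i j a = Sum.inr i := by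
    have : (Sum.inr i : Fin (n + 1) ⊕ Fin k) ∉ range (levelLabel i j) := by
      rw [range_levelLabel]
      simp
    exact this
  have hτw : ∀ w : Fin (n + 1) ⊕ Fin k → ℝ, w (Sum.inr i) = z (Sum.inr i) →
      τ (w ∘ levelLabel i j) = w := by
    intro w hw
    funext c
    by_cases hc : c = Sum.inr i
    · rw [hc, hw]
      exact Function.extend_apply' _ _ _ hni
    · obtain ⟨a, rfl⟩ : c ∈ range (levelLabel i j) := by
        rw [range_levelLabel]
        exact hc
      exact hσ.extend_apply _ _ _
  convert (h (levelLabel i j ⁻¹' S) (z ∘ levelLabel i j)).image τ hτ.continuousOn using 1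
  rw [levelGraph_eq]
  ext w
  constructor
  · rintro ⟨hw, hwS⟩
    exact ⟨_, ⟨⟨w, ⟨hw, hwS _ hi⟩, rfl⟩, fun s hs => hwS _ hs⟩, hτw w (hwS _ hi)⟩
  · rintro ⟨_, ⟨⟨w, ⟨hw, hwi : w (Sum.inr i) = z (Sum.inr i)⟩, rfl⟩, hwS⟩, rfl⟩
    rw [hτw w hwi]
    refine ⟨hw, fun s hs => ?_⟩
    by_cases hsi : s = Sum.inr i
    · rw [hsi, hwi]
    · obtain ⟨s, rfl⟩ : s ∈ range (levelLabel i j) := by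
        rw [range_levelLabel]
        exact hsi
      exact hwS s hs

end Dichotomy

theorem IsMonotoneMap.isBoundedContinuousMap {k : ℕ} : ∀ {n : ℕ} {X : Set (Fin n → ℝ)}
    {f : (Fin n → ℝ) → Fin k → ℝ}, IsMonotoneMap L n X f → IsBoundedContinuousMap L X f
  | 0, _, _, h => h
  | 1, _, _, h => h.1
  | _ + 2, _, _, h => h.1

theorem IsBoundedContinuousMap.exists_represents {n k : ℕ} {X : Set (Fin n → ℝ)}
    {f : (Fin n → ℝ) → Fin k → ℝ} (h : IsBoundedContinuousMap L X f)
    (hsl : HasConnectedSlices (graphOf X f))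
    (hd : ∀ B, IsChart (graphOf X f) n B → ∀ a ∈ B, ∀ e ∉ B,
      (∀ c, Determines (graphOf X f) (insert e (B \ {a})) c) ∨
        Determines (graphOf X f) (B \ {a}) e) :
    ∃ M : Matroid (Fin n ⊕ Fin k), M.E = univ ∧ Represents M (graphOf X f) ∧
      M.IsBase (range Sum.inl) := by
  obtain ⟨M, hE, hM, B, hB, hcard⟩ := _root_.exists_represents (h.nonempty.image _) hsl
    ⟨_, h.isChart⟩ hd
  refine ⟨M, hE, hM, (hM.isBase_iff hE hB).2 ⟨?_, h.isChart.determines⟩⟩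
  rw [ncard_range_inl, hcard]

/-- A component that is not independent of the coordinate is injective, so slices fixing it have at
most one point. Charts are singletons, so no exchange can keep a target coordinate. -/
theorem exists_represents_of_dim_one {k : ℕ} {X : Set (Fin 1 → ℝ)} {f : (Fin 1 → ℝ) → Fin k → ℝ}
    (h : IsMonotoneMap L 1 X f) :
    ∃ M : Matroid (Fin 1 ⊕ Fin k), M.E = univ ∧ Represents M (graphOf X f) ∧
      M.IsBase (range Sum.inl) := by
  obtain ⟨hbc, hmon⟩ := h
  have hinj : ∀ i j, ¬ IndependentOf X (fun x => f x i) j →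
      ∀ c, Determines (graphOf X f) {Sum.inr i} c := by
    intro i j hij c
    rintro _ ⟨x, hx, rfl⟩ _ ⟨y, hy, rfl⟩ hxy
    have hxy' : f x i = f y i := hxy _ rfl
    have hother : ∀ x y : Fin 1 → ℝ, ∀ a, a ≠ j → x a = y a := fun _ _ a ha =>
      absurd (Subsingleton.elim a j) ha
    have : x = y := by
      funext a
      rw [Subsingleton.elim a j]
      by_contra hne
      rcases (hmon i).coordinate j with hm | hm | hm
      · rcases lt_or_gt_of_ne hne with hlt | hlt
        · exact (hm x hx y hy (hother _ _) hlt).ne hxy'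
        · exact (hm y hy x hx (hother _ _) hlt).ne' hxy'
      · rcases lt_or_gt_of_ne hne with hlt | hlt
        · exact (hm x hx y hy (hother _ _) hlt).ne' hxy'
        · exact (hm y hy x hx (hother _ _) hlt).ne hxy'
      · exact hij hm
    rw [this]
  refine hbc.exists_represents (hbc.hasConnectedSlices fun i j hij S z hi => ?_)
    (chart_dichotomy (fun i j hij c => (hinj i j hij c).mono (by simp))
      fun i B hB hi a ha hai => ?_)
  · refine Set.Subsingleton.isPreconnected ?_
    rintro v ⟨hv, hvS⟩ w ⟨hw, hwS⟩
    refine eq_of_determines (hinj i j hij) hv hw ?_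
    rintro _ rfl
    rw [hvS _ hi, hwS _ hi]
  · obtain ⟨c, rfl⟩ := ncard_eq_one.1 hB.card
    exact absurd (ha.trans hi.symm) hai

theorem IsMonotoneMap.exists_represents {k : ℕ} : ∀ (n : ℕ) (X : Set (Fin n → ℝ))
    (f : (Fin n → ℝ) → Fin k → ℝ), IsMonotoneMap L n X f →
      ∃ M : Matroid (Fin n ⊕ Fin k), M.E = univ ∧ Represents M (graphOf X f) ∧
        M.IsBase (range Sum.inl) := by
  intro n
  induction n with
  | zero =>
    intro X f h
    have hbc : IsBoundedContinuousMap L X f := h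
    have hsub : (graphOf X f).Subsingleton := (subsingleton_of_subsingleton (s := X)).image _
    refine hbc.exists_represents (fun S z => (hsub.anti inter_subset_left).isPreconnected) ?_
    intro B hB a ha
    rw [(ncard_eq_zero (toFinite B)).1 hB.card] at ha
    exact absurd ha (notMem_empty a)
  | succ n ih =>
    cases n with
    | zero => exact fun X f h => exists_represents_of_dim_one h
    | succ n =>
      rintro X f ⟨hbc, hmon⟩
      have hlevel : ∀ i j, ¬ IndependentOf X (fun x => f x i) j → ∀ b,
          (levelGraph X f i j b).Nonempty →
          ∃ M : Matroid (Fin (n + 1) ⊕ Fin k), M.E = univ ∧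
            Represents M (levelGraph X f i j b) ∧ M.IsBase (range Sum.inl) := by
        intro i j hij b hne
        obtain ⟨Y, g, hY, -⟩ := hmon i j hij
        rw [(hY b hne).1]
        exact ih _ _ (hY b hne).2
      refine hbc.exists_represents (hbc.hasConnectedSlices fun i j hij S z hi => ?_)
        (chart_dichotomy (fun i j hij => ?_) fun i B hB hi a ha hai e he => ?_)
      · refine isPreconnected_slice_of_level hi z (j := j) ?_
        rcases (levelGraph X f i j (z (Sum.inr i))).eq_empty_or_nonempty with h0 | hne
        · rw [h0]
          intro S' z'
          rw [empty_inter]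
          exact isPreconnected_empty
        · obtain ⟨M, -, hM, -⟩ := hlevel i j hij _ hne
          exact hM.slices
      · refine determines_all_of_level (mem_insert _ _) (S := range Sum.inl)
          (by rw [levelLabel_image_inl i j]; exact subset_insert _ _) fun b hne c => ?_
        obtain ⟨M, hE, hM, hMB⟩ := hlevel i j hij b hne
        exact hM.determines _ _ (by rw [hMB.closure_eq, hE]; trivial)
      -- A chart containing `y i` lets it move, so this component is not constant and its level sets
      -- are covered by the definition of a monotone map.
      · have hnc : ¬ Determines (graphOf X f) ∅ (Sum.inr i) := by
          intro hcon
          obtain ⟨z, hz⟩ := hbc.nonempty.image (fun x => (Sum.elim x (f x) : _ ⊕ Fin k → ℝ))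
          obtain ⟨w, hw, hne, -⟩ := hB.projectsOpenly.exists_move hz hi
          exact hne (hcon w hw z hz (by simp))
        obtain ⟨j, hij⟩ := hbc.exists_not_independentOf hnc
        obtain ⟨Y, g, hY, hsame⟩ := hmon i j hij
        have hσ := levelLabel_injective i j
        have hrange : ∀ c, c ≠ Sum.inr i → ∃ c', levelLabel i j c' = c := fun c hc => by
          have : c ∈ range (levelLabel i j) := by rw [range_levelLabel]; exact hc
          exact this
        obtain ⟨a, rfl⟩ := hrange a hai
        obtain ⟨e, rfl⟩ := hrange e (fun h => he (h ▸ hi))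
        -- `B'` is `B` without `y i`, relabelled; it has `n + 1` elements and is a base of the
        -- matroid of every nonempty level set.
        set B' := levelLabel i j ⁻¹' B with hB'
        have himg : levelLabel i j '' B' = B \ {Sum.inr i} := by
          rw [hB', image_preimage_eq_inter_range, range_levelLabel]
          rfl
        have hcard : B'.ncard = n + 1 := by
          rw [← ncard_image_of_injective B' hσ, himg, ncard_sdiff_singleton_of_mem hi, hB.card]
          rfl
        have himg' : levelLabel i j '' (B' \ {a}) ⊆ B \ {levelLabel i j a} := by
          rintro _ ⟨s, ⟨hs, hsa⟩, rfl⟩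
          exact ⟨hs, fun h => hsa (hσ h)⟩
        have hiB : Sum.inr i ∈ B \ {levelLabel i j a} := ⟨hi, fun h => hai h.symm⟩
        -- By condition (ii) the exchanged set is a basis set on all nonempty levels or on none. In
        -- the first case it determines everything; in the second, `e` lies in the closure of `B' \
        -- {a}` on each level.
        by_cases hcase : ∃ b, (levelGraph X f i j b).Nonempty ∧
            IsBasisSet (Y b) (g b) (insert e (B' \ {a}))
        · left
          obtain ⟨b, hb, hbasis⟩ := hcase
          refine determines_all_of_level (i := i) (j := j) (S := insert e (B' \ {a})) (Or.inr hiB)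
            ?_ fun b' hb' => ?_
          · rw [image_insert_eq]
            exact insert_subset_insert himg'
          · rw [(hY b' hb').1]
            exact (isBasisSet_iff.1 ((hsame b b' hb hb' _).1 hbasis)).2
        · right
          refine determines_of_level hiB himg' fun b hb => ?_
          obtain ⟨M, hE, hM, hMB⟩ := ih _ _ (hY b hb).2
          have hB'b : M.IsBase B' := by
            refine (hM.isBase_iff_isBasisSet hE hMB B').2 (isBasisSet_iff.2 ⟨hcard, fun c => ?_⟩)
            rw [← (hY b hb).1]
            exact determines_level (hB.determines _) b
          rw [(hY b hb).1]
          refine hM.determines _ _ ?_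
          by_contra hcl
          exact hcase ⟨b, hb, (hM.isBase_iff_isBasisSet hE hMB _).1
            (hB'b.exchange_base_of_notMem_closure ha hcl (by rw [hE]; trivial))⟩

/-! ### Projections of the graph of a monotone map -/

/-- The projection of the graph of a monotone map to the span of any set `I` of coordinates is
semi-monotone or the graph of a monotone map `g`. In the second case `e` labels the coordinates
in `I` by the domain and target coordinates of `g`; through `e`, the matroid `m'` of `g` becomes a
matroid with ground set `I`. -/
theorem theorem4p6 (L : FirstOrder.Language.{u, v}) [L.Structure ℝ] (hL : IsOMinimal L)
    (n k : ℕ) (X : Set (Fin n → ℝ)) (f : (Fin n → ℝ) → Fin k → ℝ)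
    (hf : IsMonotoneMap L n X f) :
    ∃ m : Matroid (Fin n ⊕ Fin k), IsAssociatedMatroid X f m ∧
      ∀ I : Set (Fin n ⊕ Fin k),
        IsSemiMonotone L (projectTo I (graphOf X f)) ∨
        ∃ (p q : ℕ) (e : Fin p ⊕ Fin q ≃ I)
          (Y : Set (Fin p → ℝ)) (g : (Fin p → ℝ) → Fin q → ℝ) (m' : Matroid (Fin p ⊕ Fin q)),
          IsMonotoneMap L p Y g ∧
          projectTo I (graphOf X f) = {z | z ∘ e ∈ graphOf Y g} ∧
          IsAssociatedMatroid Y g m' ∧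
          (m'.mapEmbedding (e.toEmbedding.trans (Function.Embedding.subtype (· ∈ I)))).IsMinor m := by
  classical
  obtain ⟨m, hE, hm, hmB⟩ := hf.exists_represents
  have hbc := hf.isBoundedContinuousMap
  have hdef : (univ : Set ℝ).Definable L (graphOf X f) := hbc.definable
  have hbd : Bornology.IsBounded (graphOf X f) := by
    obtain ⟨C, hC⟩ := hbc.semiMonotone.isBounded.exists_norm_le
    obtain ⟨D, hD⟩ := hbc.bounded.exists_norm_le
    refine isBounded_iff_forall_norm_le.2 ⟨max (max C D) 0, ?_⟩
    rintro _ ⟨x, hx, rfl⟩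
    refine (pi_norm_le_iff_of_nonneg (le_max_right _ _)).2 fun c => ?_
    refine le_trans ?_ (le_max_left _ _)
    rcases c with j | i
    · exact (norm_le_pi_norm x j).trans ((hC x hx).trans (le_max_left _ _))
    · exact (norm_le_pi_norm (f x) i).trans ((hD _ ⟨x, hx, rfl⟩).trans (le_max_right _ _))
  refine ⟨m, ⟨hE, hm.isBase_iff_isBasisSet hE hmB⟩, fun I => ?_⟩
  obtain ⟨J, hJ⟩ := m.exists_isBasis I (by rw [hE]; exact subset_univ _)
  by_cases hJI : J = I
  · left
    refine hm.isSemiMonotone_image (σ := ((↑) : I → Fin n ⊕ Fin k)) Subtype.val_injective ?_ hdef hbd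
    rw [Subtype.range_coe, ← hJI]
    exact hJ.indep
  right
  -- The basis `J` labels the domain coordinates of `g`, and `I \ J`, nonempty here, its target
  -- coordinates.
  let eJ : Fin (Nat.card J) ≃ J := (Finite.equivFin J).symm
  let eK : Fin (Nat.card (I \ J : Set _)) ≃ (I \ J : Set _) := (Finite.equivFin _).symm
  let e : Fin (Nat.card J) ⊕ Fin (Nat.card (I \ J : Set _)) ≃ I :=
    (Equiv.sumCongr eJ eK).trans (Equiv.Set.sumDiffSubset hJ.subset)
  let σ : Fin (Nat.card J) ⊕ Fin (Nat.card (I \ J : Set _)) → Fin n ⊕ Fin k := fun c => e c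
  have hσ : σ.Injective := Subtype.val_injective.comp e.injective
  have hσI : range σ = I := by
    ext c
    exact ⟨by rintro ⟨a, rfl⟩; exact (e a).2, fun hc =>
      ⟨e.symm ⟨c, hc⟩, congrArg Subtype.val (e.apply_symm_apply ⟨c, hc⟩)⟩⟩
  have hσJ : σ '' range Sum.inl = J := by
    ext c
    constructor
    · rintro ⟨_, ⟨a, rfl⟩, rfl⟩
      exact (eJ a).2
    · exact fun hc => ⟨_, ⟨eJ.symm ⟨c, hc⟩, rfl⟩,
        congrArg Subtype.val (eJ.apply_symm_apply ⟨c, hc⟩)⟩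
  have hq : 1 ≤ Nat.card (I \ J : Set _) := by
    obtain ⟨c, hc⟩ : (I \ J).Nonempty := by
      rw [sdiff_nonempty]
      exact fun h => hJI (hJ.subset.antisymm h)
    exact Nat.card_pos_iff.2 ⟨⟨⟨c, hc⟩⟩, inferInstance⟩
  have hNE : (m.comap σ).E = univ := by rw [Matroid.comap_ground_eq, hE, preimage_univ]
  have hNB : (m.comap σ).IsBase (range Sum.inl) := by
    rw [Matroid.isBase_iff_indep_closure_eq, hNE, Matroid.comap_indep_iff,
      Matroid.comap_closure_eq, hσJ]
    refine ⟨⟨hJ.indep, hσ.injOn⟩, eq_univ_of_forall fun c => hJ.subset_closure (e c).2⟩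
  have hN := hm.comap hσ
  obtain ⟨Y, g, hYg⟩ := exists_eq_graphOf fun c => hN.determines (range Sum.inl) c (by
    rw [hNB.closure_eq, hNE]; trivial)
  have hN' := hN
  rw [hYg] at hN'
  refine ⟨_, _, e, Y, g, m.comap σ, ?_, ?_, ⟨hNE, hN'.isBase_iff_isBasisSet hNE hNB⟩, ?_⟩
  · refine hN'.isMonotoneMap hL hq _ _ _ _ hNE hNB ?_ ?_
    · rw [← hYg]
      exact hdef.image_comp σ
    · rw [← hYg]
      exact isBounded_image_comp hbd σ
  · rw [← hYg]
    ext z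
    constructor
    · rintro ⟨w, hw, rfl⟩
      exact ⟨w, hw, rfl⟩
    · rintro ⟨w, hw, hwz⟩
      refine ⟨w, hw, funext fun c => ?_⟩
      have := congrFun hwz (e.symm c)
      change w (e (e.symm c)) = z (e (e.symm c)) at this
      rwa [e.apply_symm_apply] at this
  -- Transported back along `e`, the matroid is the restriction of `m` to `I`: contract nothing and
  -- delete `Iᶜ`.
  · refine ⟨∅, Iᶜ, Matroid.ext_indep ?_ fun K _ => ?_⟩
    · rw [Matroid.mapEmbedding_ground_eq, hNE, image_univ, Matroid.delete_ground,
        Matroid.contract_ground, hE]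
      change range σ = _
      rw [hσI]
      simp
    · rw [Matroid.mapEmbedding_indep_iff, Matroid.comap_indep_iff, Matroid.delete_indep_iff,
        Matroid.contract_empty, disjoint_compl_right_iff_subset]
      change (m.Indep (σ '' (σ ⁻¹' K)) ∧ _) ∧ K ⊆ range σ ↔ _
      rw [hσI]
      refine ⟨fun ⟨h1, h2⟩ => ⟨?_, h2⟩, fun ⟨h1, h2⟩ => ⟨⟨?_, hσ.injOn⟩, h2⟩⟩
      · rw [image_preimage_eq_of_subset (by rwa [hσI])] at h1
        exact h1.1
      · rw [image_preimage_eq_of_subset (by rwa [hσI])]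
        exact h1
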